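/- **Lemma (Bias).** Let $d\ge 1$, $\mathcal Y=[0,1]$, $\mathcal X=[0,1]^d$. Derivatives on these closed sets are one-sided at the boundary. *Data.* $(y_i,\mathbf x_i)$, $i\ge 1$, are i.i.d. on $\mathcal Y\times\mathcal X$ with a joint Lebesgue density $f$ that is continuous and bounded away from zero on $\mathcal Y\times\mathcal X$. Write $f_{\mathbf x}(\mathbf x)=\int_0^1 f(u,\mathbf x)\,du$, $F(y|\mathbf x)=\int_0^y f(u,\mathbf x)\,du/f_{\mathbf x}(\mathbf x)$ and $\theta_{\mu,\boldsymbol\nu}(y,\mathbf x)=\partial_y^{\mu}\partial_{\mathbf x}^{\boldsymbol\nu}F(y|\mathbf x)$; $\theta_{2,\mathbf 0}$ exists and is continuous on $\mathcal Y\times\mathcal X$. *Kernel and weight.* $K:\mathbb R\to\mathbb R$ is nonnegative, symmetric, supported on $[-1,1]$, Lipschitz continuous and integrates to one; $L(\mathbf v)=\prod_{j=1}^d K(v_j)$. $G$ is continuously differentiable on $[0,1]$ with derivative $g$. *Notation.* Let $\mathfrak p,\mathfrak q\in\mathbb N$, $0\le\mu\le\mathfrak p$, and let $\boldsymbol\nu\in\mathbb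 N^d$ be a multi-index with $|\boldsymbol\nu|\le\mathfrak q$. Put $\mathbf p(u)=(u^k/k!)_{0\le k\le\mathfrak p}$, $\mathbf q(\mathbf v)=(\mathbf v^{\mathbf m}/\mathbf m!)_{|\mathbf m|\le\mathfrak q}$, $\mathbf P=\mathbf pK$, $\mathbf Q=\mathbf qL$; $\mathbf e_\mu,\mathbf e_{\boldsymbol\nu}$ are the standard basis vectors extracting the $\mu$-th entry of $\mathbf p$ and the $\boldsymbol\nu$-th entry of $\mathbf q$. For a bandwidth $h>0$ let $$\mathbf S_y=\int_{(\mathcal Y-y)/h}\mathbf p(u)\mathbf P(u)^{\mathrm T}g(y+hu)\,du,\qquad \mathbf c_{y,\ell}=\int_{(\mathcal Y-y)/h}\frac{u^\ell}{\ell!}\mathbf P(u)g(y+hu)\,du,$$ $$\mathbf S_{\mathbf x}=\int_{(\mathcal X-\mathbf x)/h}\mathbf q(\mathbf v)\mathbf Q(\mathbf v)^{\mathrm T}f_{\mathbf x}(\mathbf x+h\mathbf v)\,d\mathbf v,\qquad \mathbf c_{\mathbf x,\mathbf m}=\int_{(\mathcal X-\mathbf x)/h}\frac{\mathbf v^{\mathbf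 m}}{\mathbf m!}\mathbf Q(\mathbf v)f_{\mathbf x}(\mathbf x+h\mathbf v)\,d\mathbf v,$$ $$\hat{\mathbf S}_y=\frac1{nh}\sum_{i=1}^n\mathbf p\Big(\frac{y_i-y}h\Big)\mathbf P\Big(\frac{y_i-y}h\Big)^{\mathrm T},\qquad \hat{\mathbf S}_{\mathbf x}=\frac1{nh^d}\sum_{i=1}^n\mathbf q\Big(\frac{\mathbf x_i-\mathbf x}h\Big)\mathbf Q\Big(\frac{\mathbf x_i-\mathbf x}h\Big)^{\mathrm T}.$$ *Claim.* Let $h=h_n>0$ be a deterministic sequence with $h\to0$ and $nh^d/\log n\to\infty$ as $n\to\infty$. Suppose that $\theta_{\mu',\boldsymbol\nu'}$ exists and is continuous on $\mathcal Y\times\mathcal X$ for all $\mu'+|\boldsymbol\nu'|=\max\{\mathfrak q+1+\mu,\ \mathfrak p+1+|\boldsymbol\nu|\}$. Fix $y\in\mathcal Y$ with $g(y)\neq0$ and $\mathbf x\in\mathcal X$. Then, as $n\to\infty$, $$\mathbf e_\mu^{\mathrm T}\mathbf S_y^{-1}\left[\frac1{nh^{\mu+|\boldsymbol\nu|}}\sum_{i=1}^n\Big(\int_{\mathcal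 Y}F(u|\mathbf x_i)\frac1h\mathbf P\Big(\frac{u-y}h\Big)dG(u)\Big)\frac1{h^d}\mathbf Q\Big(\frac{\mathbf x_i-\mathbf x}h\Big)^{\mathrm T}\right]\hat{\mathbf S}_{\mathbf x}^{-1}\mathbf e_{\boldsymbol\nu}=\theta_{\mu,\boldsymbol\nu}(y,\mathbf x)+\mathsf B_{\mu,\boldsymbol\nu}(y,\mathbf x)+o_{\mathbb P}\big(h^{\mathfrak q+1-|\boldsymbol\nu|}+h^{\mathfrak p+1-\mu}\big)$$ and $$\mathbf e_\mu^{\mathrm T}\hat{\mathbf S}_y^{-1}\left[\frac1{n^2h^{\mu+|\boldsymbol\nu|}}\sum_{i=1}^n\sum_{j=1}^nF(y_j|\mathbf x_i)\frac1h\mathbf P\Big(\frac{y_j-y}h\Big)\frac1{h^d}\mathbf Q\Big(\frac{\mathbf x_i-\mathbf x}h\Big)^{\mathrm T}\right]\hat{\mathbf S}_{\mathbf x}^{-1}\mathbf e_{\boldsymbol\nu}=\theta_{\mu,\boldsymbol\nu}(y,\mathbf x)+\mathsf B_{\mu,\boldsymbol\nu}(y,\mathbf x)+o_{\mathbb P}\big(h^{\mathfrak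 q+1-|\boldsymbol\nu|}+h^{\mathfrak p+1-\mu}\big),$$ where $$\mathsf B_{\mu,\boldsymbol\nu}(y,\mathbf x)=h^{\mathfrak q+1-|\boldsymbol\nu|}\sum_{|\mathbf m|=\mathfrak q+1}\theta_{\mu,\mathbf m}(y,\mathbf x)\,\mathbf c_{\mathbf x,\mathbf m}^{\mathrm T}\mathbf S_{\mathbf x}^{-1}\mathbf e_{\boldsymbol\nu}+h^{\mathfrak p+1-\mu}\,\theta_{\mathfrak p+1,\boldsymbol\nu}(y,\mathbf x)\,\mathbf c_{y,\mathfrak p+1}^{\mathrm T}\mathbf S_y^{-1}\mathbf e_\mu.$$ -/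

import Mathlib

open MeasureTheory ProbabilityTheory Filter Topology

namespace CondDist

noncomputable section

/-! ### Partial derivatives on the closed unit cube -/

/-- The partial derivative in coordinate `i` of a function on the closed cube `[0,1]^N`
(one-sided at the faces of the cube). -/
def cubePartial {N : ℕ} (i : Fin N) (Φ : (Fin N → ℝ) → ℝ) : (Fin N → ℝ) → ℝ :=
  fun z => derivWithin (fun t => Φ (Function.update z i t)) (Set.Icc 0 1) (z i)

/-- `∂_{i₁} (∂_{i₂} ( ⋯ (∂_{i_k} Φ)))` for the list `[i₁, …, i_k]`. -/
def iterPartial {N : ℕ} : List (Fin N) → ((Fin N → ℝ) → ℝ) → (Fin N → ℝ) → ℝ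
  | [], Φ => Φ
  | i :: w, Φ => cubePartial i (iterPartial w Φ)

/-- The iterated partial derivative `∂_{i₁} (∂_{i₂} ( ⋯ (∂_{i_k} Φ)))` exists at every point of the
closed cube: each successive one-variable (one-sided at the faces) derivative exists. -/
def IterPartialExists {N : ℕ} : List (Fin N) → ((Fin N → ℝ) → ℝ) → Prop
  | [], _ => True
  | i :: w, Φ => IterPartialExists w Φ ∧ ∀ z ∈ Set.Icc (0 : Fin N → ℝ) 1,
      DifferentiableWithinAt ℝ (fun t => iterPartial w Φ (Function.update z i t))
        (Set.Icc 0 1) (z i)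

/-- The list `[0, …, 0, 1, …, 1, …]` in which coordinate `i` occurs `m i` times. -/
def multiWord {N : ℕ} (m : Fin N → ℕ) : List (Fin N) :=
  (List.finRange N).flatMap fun i => List.replicate (m i) i

/-! ### The conditional distribution function and its derivatives -/

/-- Marginal density of the covariates, `f_x(x) = ∫_{[0,1]} f(u, x) du`. -/
def marginalX {d : ℕ} (f : ℝ → (Fin d → ℝ) → ℝ) (x : Fin d → ℝ) : ℝ :=
  ∫ u in Set.Icc (0 : ℝ) 1, f u x

/-- Conditional density `f(y | x) = f(y, x) / f_x(x)`. -/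
def condDensity {d : ℕ} (f : ℝ → (Fin d → ℝ) → ℝ) (y : ℝ) (x : Fin d → ℝ) : ℝ :=
  f y x / marginalX f x

/-- Conditional distribution function `F(y | x) = ∫_0^y f(u | x) du` for `y ∈ [0,1]`. -/
def condCDF {d : ℕ} (f : ℝ → (Fin d → ℝ) → ℝ) (y : ℝ) (x : Fin d → ℝ) : ℝ :=
  ∫ u in Set.Icc (0 : ℝ) y, condDensity f u x

/-- `F(y | x)` as a function of the single variable `z = (y, x) ∈ [0,1]^{1+d}`. -/
def condCDFJoint {d : ℕ} (f : ℝ → (Fin d → ℝ) → ℝ) (z : Fin (d + 1) → ℝ) : ℝ :=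
  condCDF f (z 0) (Fin.tail z)

/-- `θ_{μ,ν}(y, x) = ∂_y^μ ∂_x^ν F(y | x)`. -/
def theta {d : ℕ} (f : ℝ → (Fin d → ℝ) → ℝ) (μ : ℕ) (ν : Fin d → ℕ)
    (y : ℝ) (x : Fin d → ℝ) : ℝ :=
  iterPartial (multiWord (Fin.cons μ ν : Fin (d + 1) → ℕ)) (condCDFJoint f)
    (Fin.cons y x : Fin (d + 1) → ℝ)

/-- `θ_{μ,ν}` exists and is continuous on `[0,1] × [0,1]^d`. -/
def ThetaExistsContinuous {d : ℕ} (f : ℝ → (Fin d → ℝ) → ℝ) (μ : ℕ) (ν : Fin d → ℕ) : Prop :=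
  IterPartialExists (multiWord (Fin.cons μ ν : Fin (d + 1) → ℕ)) (condCDFJoint f) ∧
  ContinuousOn (fun z : ℝ × (Fin d → ℝ) => theta f μ ν z.1 z.2)
    (Set.Icc (0 : ℝ) 1 ×ˢ Set.Icc (0 : Fin d → ℝ) 1)

/-! ### Assumptions -/

/-- Data generating process: `(Y i, X i)` is a random sample from a distribution on
`[0,1] × [0,1]^d` with joint Lebesgue density `f`, which is continuous and bounded away from zero
on that cube, and `θ_{2,0}` exists and is continuous. -/
structure IsDGP {Ω : Type*} [MeasurableSpace Ω] (P : Measure Ω) {d : ℕ}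
    (Y : ℕ → Ω → ℝ) (X : ℕ → Ω → Fin d → ℝ) (f : ℝ → (Fin d → ℝ) → ℝ) : Prop where
  measurable_Y : ∀ i, Measurable (Y i)
  measurable_X : ∀ i, Measurable (X i)
  indep : iIndepFun (fun i ω => (Y i ω, X i ω)) P
  law : ∀ i, P.map (fun ω => (Y i ω, X i ω)) =
    ((volume : Measure (ℝ × (Fin d → ℝ))).restrict
      (Set.Icc (0 : ℝ) 1 ×ˢ Set.Icc (0 : Fin d → ℝ) 1)).withDensity
        fun z => ENNReal.ofReal (f z.1 z.2)
  density_continuous : ContinuousOn (fun z : ℝ × (Fin d → ℝ) => f z.1 z.2)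
    (Set.Icc (0 : ℝ) 1 ×ˢ Set.Icc (0 : Fin d → ℝ) 1)
  density_lower : ∃ c : ℝ, 0 < c ∧
    ∀ y ∈ Set.Icc (0 : ℝ) 1, ∀ x ∈ Set.Icc (0 : Fin d → ℝ) 1, c ≤ f y x
  theta_two : ThetaExistsContinuous f 2 0

/-- The kernel is nonnegative, symmetric, supported on `[-1,1]`, Lipschitz continuous, and
integrates to one. -/
structure IsKernelFun (K : ℝ → ℝ) : Prop where
  nonneg : ∀ u, 0 ≤ K u
  symmetric : ∀ u, K (-u) = K u
  support : Function.support K ⊆ Set.Icc (-1) 1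
  lipschitz : ∃ C : NNReal, LipschitzWith C K
  integral_one : ∫ u, K u = 1

/-- The Lebesgue density `g = G'` on `[0,1]` of a weighting function `G` that is continuously
differentiable on `[0,1]`. -/
def weightDensity (G : ℝ → ℝ) (u : ℝ) : ℝ := derivWithin G (Set.Icc 0 1) u

/-- The Lebesgue-Stieltjes integral `∫_{[0,1]} φ(u) dG(u)`, for a weighting function `G` that is
continuously differentiable on `[0,1]`, so that `dG(u) = g(u) du` there. -/
def integralDG (G : ℝ → ℝ) (φ : ℝ → ℝ) : ℝ :=
  ∫ u in Set.Icc (0 : ℝ) 1, φ u * weightDensity G u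

/-! ### Polynomial bases and kernels -/

/-- The multi-indices `m ∈ ℕ^d` with `|m| ≤ q`. -/
def multiIdx (d q : ℕ) : Finset (Fin d → ℕ) :=
  (Fintype.piFinset fun _ => Finset.range (q + 1)).filter fun m => ∑ j, m j ≤ q

/-- The scaled monomial `v^m / m!`. -/
def mono {d : ℕ} (m : Fin d → ℕ) (v : Fin d → ℝ) : ℝ :=
  ∏ j, (v j ^ m j / ((m j).factorial : ℝ))

/-- `p(u) = (1, u, u²/2, …, u^p/p!)`. -/
def pVec (p : ℕ) (u : ℝ) : Fin (p + 1) → ℝ :=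
  fun k => u ^ (k : ℕ) / ((k : ℕ).factorial : ℝ)

/-- `q(v) = (v^m / m!)_{|m| ≤ q}`. -/
def qVec {d : ℕ} (q : ℕ) (v : Fin d → ℝ) : multiIdx d q → ℝ := fun m => mono m.1 v

/-- The product kernel `L(v) = K(v_1) ⋯ K(v_d)`. -/
def prodKernel {d : ℕ} (K : ℝ → ℝ) (v : Fin d → ℝ) : ℝ := ∏ j, K (v j)

/-- `P = p K`. -/
def PVec (K : ℝ → ℝ) (p : ℕ) (u : ℝ) : Fin (p + 1) → ℝ := fun k => pVec p u k * K u

/-- `Q = q L`. -/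
def QVec {d : ℕ} (K : ℝ → ℝ) (q : ℕ) (v : Fin d → ℝ) : multiIdx d q → ℝ :=
  fun m => qVec q v m * prodKernel K v

/-- The basis vector `e_μ` extracting the `μ`-th element of `p`. -/
def eY (p μ : ℕ) : Fin (p + 1) → ℝ := fun k => if (k : ℕ) = μ then 1 else 0

/-- The basis vector `e_ν` extracting the `ν`-th element of `q`. -/
def eX {d : ℕ} (q : ℕ) (ν : Fin d → ℕ) : multiIdx d q → ℝ := fun m => if m.1 = ν then 1 else 0

/-- `(x' - x) / h`. -/
def scaled {d : ℕ} (h : ℝ) (x x' : Fin d → ℝ) : Fin d → ℝ := fun j => (x' j - x j) / h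

/-! ### The matrices `S` and `c` -/

/-- `S_y = ∫_{([0,1]-y)/h} p(u) P(u)ᵀ g(y+hu) du`. -/
def SY (K G : ℝ → ℝ) (p : ℕ) (h y : ℝ) : Matrix (Fin (p + 1)) (Fin (p + 1)) ℝ :=
  Matrix.of fun a b => ∫ u in {u : ℝ | y + h * u ∈ Set.Icc (0 : ℝ) 1},
    pVec p u a * PVec K p u b * weightDensity G (y + h * u)

/-- `c_{y,ℓ} = ∫_{([0,1]-y)/h} (u^ℓ/ℓ!) P(u) g(y+hu) du`. -/
def cY (K G : ℝ → ℝ) (p ℓ : ℕ) (h y : ℝ) : Fin (p + 1) → ℝ :=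
  fun a => ∫ u in {u : ℝ | y + h * u ∈ Set.Icc (0 : ℝ) 1},
    u ^ ℓ / (ℓ.factorial : ℝ) * PVec K p u a * weightDensity G (y + h * u)

/-- `S_x = ∫_{([0,1]^d-x)/h} q(v) Q(v)ᵀ f_x(x+hv) dv`. -/
def SX {d : ℕ} (K : ℝ → ℝ) (f : ℝ → (Fin d → ℝ) → ℝ) (q : ℕ) (h : ℝ) (x : Fin d → ℝ) :
    Matrix (multiIdx d q) (multiIdx d q) ℝ :=
  Matrix.of fun a b => ∫ v in {v : Fin d → ℝ | x + h • v ∈ Set.Icc (0 : Fin d → ℝ) 1},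
    qVec q v a * QVec K q v b * marginalX f (x + h • v)

/-- `c_{x,m} = ∫_{([0,1]^d-x)/h} (v^m/m!) Q(v) f_x(x+hv) dv`. -/
def cX {d : ℕ} (K : ℝ → ℝ) (f : ℝ → (Fin d → ℝ) → ℝ) (q : ℕ) (m : Fin d → ℕ) (h : ℝ)
    (x : Fin d → ℝ) : multiIdx d q → ℝ :=
  fun a => ∫ v in {v : Fin d → ℝ | x + h • v ∈ Set.Icc (0 : Fin d → ℝ) 1},
    mono m v * QVec K q v a * marginalX f (x + h • v)

/-- `Ŝ_y = (nh)⁻¹ ∑_{i ≤ n} p((y_i-y)/h) P((y_i-y)/h)ᵀ` for the data `ys`. -/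
def SYhat (K : ℝ → ℝ) (p n : ℕ) (ys : ℕ → ℝ) (h y : ℝ) :
    Matrix (Fin (p + 1)) (Fin (p + 1)) ℝ :=
  Matrix.of fun a b => 1 / ((n : ℝ) * h) *
    ∑ i ∈ Finset.range n, pVec p ((ys i - y) / h) a * PVec K p ((ys i - y) / h) b

/-- `Ŝ_x = (nh^d)⁻¹ ∑_{i ≤ n} q((x_i-x)/h) Q((x_i-x)/h)ᵀ` for the data `xs`. -/
def SXhat {d : ℕ} (K : ℝ → ℝ) (q n : ℕ) (xs : ℕ → Fin d → ℝ) (h : ℝ) (x : Fin d → ℝ) :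
    Matrix (multiIdx d q) (multiIdx d q) ℝ :=
  Matrix.of fun a b => 1 / ((n : ℝ) * h ^ d) *
    ∑ i ∈ Finset.range n, qVec q (scaled h x (xs i)) a * QVec K q (scaled h x (xs i)) b

/-! ### Conditional-mean parts of the two estimators, and the leading bias -/

/-- The bracketed matrix for the estimator with local smoothing,
`(n h^{μ+|ν|})⁻¹ ∑_i (∫ F(u|x_i) h⁻¹ P((u-y)/h) dG(u)) h^{-d} Q((x_i-x)/h)ᵀ`. -/
def RbarMean {d : ℕ} (K G : ℝ → ℝ) (f : ℝ → (Fin d → ℝ) → ℝ) (p q μ : ℕ) (ν : Fin d → ℕ)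
    (n : ℕ) (xs : ℕ → Fin d → ℝ) (h y : ℝ) (x : Fin d → ℝ) :
    Matrix (Fin (p + 1)) (multiIdx d q) ℝ :=
  Matrix.of fun a m => 1 / ((n : ℝ) * h ^ (μ + ∑ j, ν j)) *
    ∑ i ∈ Finset.range n,
      integralDG G (fun u => condCDF f u (xs i) * (1 / h * PVec K p ((u - y) / h) a)) *
        (1 / h ^ d * QVec K q (scaled h x (xs i)) m)

/-- The bracketed matrix for the estimator by local regression,
`(n² h^{μ+|ν|})⁻¹ ∑_i ∑_j F(y_j|x_i) h⁻¹ P((y_j-y)/h) h^{-d} Q((x_i-x)/h)ᵀ`. -/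
def RhatMean {d : ℕ} (K : ℝ → ℝ) (f : ℝ → (Fin d → ℝ) → ℝ) (p q μ : ℕ) (ν : Fin d → ℕ)
    (n : ℕ) (ys : ℕ → ℝ) (xs : ℕ → Fin d → ℝ) (h y : ℝ) (x : Fin d → ℝ) :
    Matrix (Fin (p + 1)) (multiIdx d q) ℝ :=
  Matrix.of fun a m => 1 / ((n : ℝ) ^ 2 * h ^ (μ + ∑ j, ν j)) *
    ∑ i ∈ Finset.range n, ∑ j ∈ Finset.range n,
      condCDF f (ys j) (xs i) * (1 / h * PVec K p ((ys j - y) / h) a) *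
        (1 / h ^ d * QVec K q (scaled h x (xs i)) m)

/-- `e_μᵀ S_y⁻¹ [RbarMean] Ŝ_x⁻¹ e_ν`. -/
def meanCheck {d : ℕ} (K G : ℝ → ℝ) (f : ℝ → (Fin d → ℝ) → ℝ) (p q μ : ℕ) (ν : Fin d → ℕ)
    (n : ℕ) (xs : ℕ → Fin d → ℝ) (h y : ℝ) (x : Fin d → ℝ) : ℝ :=
  eY p μ ⬝ᵥ ((SY K G p h y)⁻¹ * RbarMean K G f p q μ ν n xs h y x *
    (SXhat K q n xs h x)⁻¹).mulVec (eX q ν)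

/-- `e_μᵀ Ŝ_y⁻¹ [RhatMean] Ŝ_x⁻¹ e_ν`. -/
def meanHat {d : ℕ} (K : ℝ → ℝ) (f : ℝ → (Fin d → ℝ) → ℝ) (p q μ : ℕ) (ν : Fin d → ℕ)
    (n : ℕ) (ys : ℕ → ℝ) (xs : ℕ → Fin d → ℝ) (h y : ℝ) (x : Fin d → ℝ) : ℝ :=
  eY p μ ⬝ᵥ ((SYhat K p n ys h y)⁻¹ * RhatMean K f p q μ ν n ys xs h y x *
    (SXhat K q n xs h x)⁻¹).mulVec (eX q ν)

/-- The leading bias `B_{μ,ν}(y, x)`. -/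
def leadingBias {d : ℕ} (K G : ℝ → ℝ) (f : ℝ → (Fin d → ℝ) → ℝ) (p q μ : ℕ) (ν : Fin d → ℕ)
    (h y : ℝ) (x : Fin d → ℝ) : ℝ :=
  h ^ (q + 1 - ∑ j, ν j) *
      (∑ m ∈ multiIdx d (q + 1) with ∑ j, m j = q + 1,
        theta f μ m y x * (cX K f q m h x ⬝ᵥ (SX K f q h x)⁻¹.mulVec (eX q ν))) +
    h ^ (p + 1 - μ) *
      (theta f (p + 1) ν y x * (cY K G p (p + 1) h y ⬝ᵥ (SY K G p h y)⁻¹.mulVec (eY p μ)))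

/-- The order of the bias, `h^{q+1-|ν|} + h^{p+1-μ}`. -/
def biasRate {d : ℕ} (p q μ : ℕ) (ν : Fin d → ℕ) (h : ℝ) : ℝ :=
  h ^ (q + 1 - ∑ j, ν j) + h ^ (p + 1 - μ)

end

end CondDist

/-!
The bracket in each estimator is an average of `F(s|w)` against kernel weights concentrated on the
`h`-neighbourhood of `(y, x)`. There `F(·|·)` may be replaced by its Taylor polynomial of order
`M = max (q + 1 + μ) (p + 1 + |ν|)`, the error `o(h^M)` being uniform on the window. In the
coordinates rescaled by `h` the bracket thus becomes
`∑_{k+|m| ≤ M} h^{k+|m|-μ-|ν|} θ_{k,m}(y,x) c_{y,k} c_{x,m}ᵀ + o(h^{M-μ-|ν|})`.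

The vectors `c_k` with `k ≤ p` are the columns of `S_y`, so `e_μᵀ S_y⁻¹ c_{y,k}` is `1` if `k = μ`
and `0` for the other `k ≤ p`, and likewise for `x`. Every Taylor term with `k ≤ p` and `|m| ≤ q`
other than `θ_{μ,ν}` is therefore annihilated exactly, however singular its power of `h`; the terms
with `k = μ, |m| = q + 1` and with `k = p + 1, m = ν` make up the bias, and the rest is of smaller
order.

The weights `e_μᵀ S_y⁻¹ c_{y,k}` do not change when all moments are multiplied by a common factor.
By the weak law the sample moments, like the population ones, converge to nonzero multiples of the
moments of the bare kernel over the tangent cone of the cube at the point, whose Gram matrix is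
invertible. Hence both kinds of weights have the same limits.
-/

namespace CondDist

open Asymptotics Matrix

/-! ### Taylor expansion on the closed cube -/

section OneVariable

theorem hasDerivAt_sub_pow_div_factorial (a : ℝ) (l : ℕ) (t : ℝ) :
    HasDerivAt (fun t : ℝ => (t - a) ^ (l + 1) / ((l + 1).factorial : ℝ))
      ((t - a) ^ l / (l.factorial : ℝ)) t := by
  refine ((((hasDerivAt_id t).sub_const a).pow (l + 1)).div_const _).congr_deriv ?_
  rw [Nat.factorial_succ]
  simp only [id, Nat.cast_mul, Nat.cast_succ, Nat.add_sub_cancel]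
  field_simp

theorem hasDerivAt_taylor_polynomial (c : ℕ → ℝ) (a : ℝ) (L : ℕ) (t : ℝ) :
    HasDerivAt (fun t => ∑ l ∈ Finset.range (L + 1), c l * ((t - a) ^ l / (l.factorial : ℝ)))
      (∑ l ∈ Finset.range L, c (l + 1) * ((t - a) ^ l / (l.factorial : ℝ))) t := by
  simp only [Finset.sum_range_succ' _ L, pow_zero]
  exact (HasDerivAt.fun_sum fun l _ =>
    (hasDerivAt_sub_pow_div_factorial a l t).const_mul (c (l + 1))).add_const _

theorem abs_sub_taylor_polynomial_le {L : ℕ} {φ : ℕ → ℝ → ℝ} {a s ε : ℝ}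
    (hφ : ∀ l < L, ∀ t ∈ Set.uIcc a s, HasDerivWithinAt (φ l) (φ (l + 1) t) (Set.uIcc a s) t)
    (hε : ∀ t ∈ Set.uIcc a s, |φ L t - φ L a| ≤ ε) :
    |φ 0 s - ∑ l ∈ Finset.range (L + 1), φ l a * ((s - a) ^ l / (l.factorial : ℝ))| ≤
      ε * |s - a| ^ L := by
  induction L generalizing φ s with
  | zero => simpa using hε s Set.right_mem_uIcc
  | succ L ih =>
    have hε₀ : 0 ≤ ε := (abs_nonneg _).trans (hε s Set.right_mem_uIcc)
    set ρ : ℝ → ℝ := fun t => φ 0 t -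
      ∑ l ∈ Finset.range (L + 2), φ l a * ((t - a) ^ l / (l.factorial : ℝ)) with hρ
    have hderiv : ∀ t ∈ Set.uIcc a s, HasDerivWithinAt ρ (φ 1 t -
        ∑ l ∈ Finset.range (L + 1), φ (l + 1) a * ((t - a) ^ l / (l.factorial : ℝ)))
        (Set.uIcc a s) t := fun t ht =>
      (hφ 0 L.succ_pos t ht).sub (hasDerivAt_taylor_polynomial _ a (L + 1) t).hasDerivWithinAt
    have hbound : ∀ t ∈ Set.uIcc a s, ‖φ 1 t -
        ∑ l ∈ Finset.range (L + 1), φ (l + 1) a * ((t - a) ^ l / (l.factorial : ℝ))‖ ≤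
          ε * |s - a| ^ L := fun t ht => by
      have hsub : Set.uIcc a t ⊆ Set.uIcc a s := Set.uIcc_subset_uIcc_left ht
      have hstep := ih (φ := fun l => φ (l + 1)) (s := t)
        (fun l hl z hz => (hφ (l + 1) (by omega) z (hsub hz)).mono hsub)
        fun z hz => hε z (hsub hz)
      have hts : |t - a| ≤ |s - a| := Set.abs_sub_left_of_mem_uIcc ht
      exact hstep.trans (by gcongr)
    have hρa : ρ a = 0 := by simp [hρ, Finset.sum_range_succ' _ (L + 1)]
    have hmvt := (convex_uIcc a s).norm_image_sub_le_of_norm_hasDerivWithin_le hderiv hbound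
      Set.left_mem_uIcc Set.right_mem_uIcc
    rw [hρa, sub_zero] at hmvt
    rw [pow_succ, ← mul_assoc]
    exact hmvt

end OneVariable

section MultiIndex

variable {N : ℕ} {i : Fin N} {m : Fin N → ℕ} {cs : List (Fin N)} {L : ℕ}

theorem mem_multiIdx : m ∈ multiIdx N L ↔ ∑ j, m j ≤ L := by
  simp only [multiIdx, Finset.mem_filter, Fintype.mem_piFinset, Finset.mem_range,
    and_iff_right_iff_imp]
  exact fun h j => Nat.lt_succ_of_le
    ((Finset.single_le_sum (fun _ _ => Nat.zero_le _) (Finset.mem_univ j)).trans h)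

theorem iterPartial_append (w w' : List (Fin N)) (Φ : (Fin N → ℝ) → ℝ) :
    iterPartial (w ++ w') Φ = iterPartial w (iterPartial w' Φ) := by
  induction w with
  | nil => rfl
  | cons i w ih => simp only [List.cons_append, iterPartial, ih]

theorem iterPartialExists_append {w w' : List (Fin N)} {Φ : (Fin N → ℝ) → ℝ} :
    IterPartialExists (w ++ w') Φ ↔
      IterPartialExists w' Φ ∧ IterPartialExists w (iterPartial w' Φ) := by
  induction w with
  | nil => simp only [List.nil_append, IterPartialExists, and_true]
  | cons i w ih =>
    simp only [List.cons_append, IterPartialExists, ih, iterPartial_append, and_assoc]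

/-- The word in which each entry `i` of the list `cs` occurs `m i` times. For
`cs = List.finRange N` this is `multiWord m`; shorter lists occur in the induction over the
coordinates that proves Taylor's formula. -/
def expWord (cs : List (Fin N)) (m : Fin N → ℕ) : List (Fin N) :=
  cs.flatMap fun i => List.replicate (m i) i

theorem expWord_append_singleton_update (hi : i ∉ cs) (m : Fin N → ℕ) (k : ℕ) :
    expWord (cs ++ [i]) (Function.update m i k) = expWord cs m ++ List.replicate k i := by
  simp only [expWord, List.flatMap_append, List.flatMap_singleton, Function.update_self]
  congr 1
  refine List.flatMap_congr fun j hj => ?_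
  rw [Function.update_of_ne (ne_of_mem_of_not_mem hj hi)]

/-- The multi-indices of total degree at most `L` supported on the coordinates in `cs`. -/
def expSet (cs : List (Fin N)) (L : ℕ) : Finset (Fin N → ℕ) :=
  (multiIdx N L).filter fun m => ∀ j, j ∉ cs → m j = 0

theorem mem_expSet : m ∈ expSet cs L ↔ ∑ j, m j ≤ L ∧ ∀ j, j ∉ cs → m j = 0 := by
  rw [expSet, Finset.mem_filter, mem_multiIdx]

theorem expSet_nil : expSet ([] : List (Fin N)) L = {0} := by
  ext m
  simp only [mem_expSet, Finset.mem_singleton, List.not_mem_nil, not_false_eq_true, true_imp_iff]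
  exact ⟨fun h => funext h.2, by rintro rfl; simp⟩

theorem expSet_finRange : expSet (List.finRange N) L = multiIdx N L := by
  ext m
  simp [mem_expSet, mem_multiIdx]

theorem sum_update_of_eq_zero (hi : m i = 0) (k : ℕ) :
    ∑ j, Function.update m i k j = k + ∑ j, m j := by
  rw [Finset.sum_update_of_mem (Finset.mem_univ i), ← Finset.sum_sdiff (Finset.subset_univ {i})]
  simp [hi]

theorem update_mem_expSet {k : ℕ} (hi : i ∉ cs) (hk : k ≤ L) (hm : m ∈ expSet cs (L - k)) :
    Function.update m i k ∈ expSet (cs ++ [i]) L := by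
  rw [mem_expSet] at hm ⊢
  refine ⟨by rw [sum_update_of_eq_zero (hm.2 i hi)]; omega, fun j hj => ?_⟩
  simp only [List.mem_append, List.mem_singleton, not_or] at hj
  rw [Function.update_of_ne hj.2, hm.2 j hj.1]

theorem update_zero_mem_expSet (hm : m ∈ expSet (cs ++ [i]) L) :
    m i ≤ L ∧ Function.update m i 0 ∈ expSet cs (L - m i) := by
  rw [mem_expSet] at hm
  have hsum := sum_update_of_eq_zero (m := Function.update m i 0) (Function.update_self i 0 m) (m i)
  simp only [Function.update_idem, Function.update_eq_self] at hsum
  refine ⟨by omega, mem_expSet.2 ⟨by omega, fun j hj => ?_⟩⟩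
  by_cases hji : j = i
  · rw [hji, Function.update_self]
  · rw [Function.update_of_ne hji]
    exact hm.2 j (by simp [hj, hji])

theorem sum_expSet_append_singleton (hi : i ∉ cs) (L : ℕ) (T : (Fin N → ℕ) → ℝ) :
    ∑ m ∈ expSet (cs ++ [i]) L, T m =
      ∑ k ∈ Finset.range (L + 1), ∑ m ∈ expSet cs (L - k), T (Function.update m i k) := by
  rw [Finset.sum_sigma']
  symm
  refine Finset.sum_bij' (fun s _ => Function.update s.2 i s.1)
    (fun m _ => ⟨m i, Function.update m i 0⟩) ?_ ?_ ?_ ?_ ?_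
  · rintro ⟨k, m⟩ hm
    rw [Finset.mem_sigma, Finset.mem_range, Nat.lt_succ_iff] at hm
    exact update_mem_expSet hi hm.1 hm.2
  · intro m hm
    rw [Finset.mem_sigma, Finset.mem_range, Nat.lt_succ_iff]
    exact update_zero_mem_expSet hm
  · rintro ⟨k, m⟩ hm
    have hmi : m i = 0 := (mem_expSet.1 (Finset.mem_sigma.1 hm).2).2 i hi
    simp [← hmi]
  · exact fun m _ => by simp
  · exact fun _ _ => rfl

theorem mono_zero (v : Fin N → ℝ) : mono 0 v = 1 := by simp [mono]

theorem mono_update (hi : m i = 0) (k : ℕ) (v : Fin N → ℝ) :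
    mono (Function.update m i k) v = mono m v * (v i ^ k / (k.factorial : ℝ)) := by
  unfold mono
  rw [← Finset.prod_erase_mul _ _ (Finset.mem_univ i),
    ← Finset.prod_erase_mul _ (fun j => v j ^ m j / ((m j).factorial : ℝ)) (Finset.mem_univ i)]
  simp only [Function.update_self, hi, pow_zero, Nat.factorial_zero, Nat.cast_one, div_one, mul_one]
  congr 1
  refine Finset.prod_congr rfl fun j hj => ?_
  rw [Function.update_of_ne (Finset.ne_of_mem_erase hj)]

theorem mono_congr_of_eq_zero {v w : Fin N → ℝ} (hvw : ∀ j, m j ≠ 0 → v j = w j) :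
    mono m v = mono m w := by
  refine Finset.prod_congr rfl fun j _ => ?_
  by_cases hj : m j = 0
  · simp only [hj, pow_zero]
  · rw [hvw j hj]

end MultiIndex

section Cube

variable {N : ℕ} {i : Fin N} {a z : Fin N → ℝ} {Φ : (Fin N → ℝ) → ℝ} {L : ℕ}

theorem update_mem_cube (hz : z ∈ Set.Icc (0 : Fin N → ℝ) 1) (i : Fin N) {t : ℝ}
    (ht : t ∈ Set.Icc (0 : ℝ) 1) : Function.update z i t ∈ Set.Icc (0 : Fin N → ℝ) 1 := by
  rw [← Set.pi_univ_Icc] at hz ⊢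
  exact Set.update_mem_pi_iff_of_mem hz |>.2 fun _ => ht

theorem norm_update_sub_le {t : ℝ} (ht : t ∈ Set.uIcc (a i) (z i)) :
    ‖Function.update z i t - a‖ ≤ ‖z - a‖ := by
  refine (pi_norm_le_iff_of_nonneg (norm_nonneg _)).2 fun j => ?_
  by_cases hj : j = i
  · subst hj
    simp only [Pi.sub_apply, Function.update_self, Real.norm_eq_abs]
    exact (Set.abs_sub_left_of_mem_uIcc ht).trans (norm_le_pi_norm (z - a) j)
  · simp only [Pi.sub_apply, Function.update_of_ne hj]
    exact norm_le_pi_norm (z - a) j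

theorem IterPartialExists.hasDerivWithinAt_replicate
    (hΦ : IterPartialExists (List.replicate L i) Φ) (hz : z ∈ Set.Icc (0 : Fin N → ℝ) 1)
    {l : ℕ} (hl : l < L) {t : ℝ} (ht : t ∈ Set.Icc (0 : ℝ) 1) :
    HasDerivWithinAt (fun t => iterPartial (List.replicate l i) Φ (Function.update z i t))
      (iterPartial (List.replicate (l + 1) i) Φ (Function.update z i t)) (Set.Icc 0 1) t := by
  obtain ⟨r, rfl⟩ := Nat.exists_eq_add_of_lt hl
  rw [show l + r + 1 = r + (l + 1) by omega, List.replicate_add, iterPartialExists_append] at hΦ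
  have hdiff := (hΦ.1.2 _ (update_mem_cube hz i ht)).hasDerivWithinAt
  simp only [Function.update_idem, Function.update_self] at hdiff
  simpa only [List.replicate_succ, iterPartial, cubePartial, Function.update_idem,
    Function.update_self] using hdiff

theorem isLittleO_sub_coordinate_taylor (ha : a ∈ Set.Icc (0 : Fin N → ℝ) 1)
    (hΦ : IterPartialExists (List.replicate L i) Φ)
    (hcont : ContinuousWithinAt (iterPartial (List.replicate L i) Φ) (Set.Icc 0 1) a) :
    (fun z => Φ z - ∑ k ∈ Finset.range (L + 1),
      iterPartial (List.replicate k i) Φ (Function.update z i (a i)) *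
        ((z i - a i) ^ k / (k.factorial : ℝ))) =o[𝓝[Set.Icc 0 1] a] fun z => ‖z - a‖ ^ L := by
  set Ψ : ℕ → (Fin N → ℝ) → ℝ := fun k => iterPartial (List.replicate k i) Φ
  refine isLittleO_iff.2 fun ε hε => ?_
  obtain ⟨δ, hδ, hδΨ⟩ := Metric.continuousWithinAt_iff.1 hcont (ε / 2) (half_pos hε)
  filter_upwards [self_mem_nhdsWithin, mem_nhdsWithin_of_mem_nhds (Metric.ball_mem_nhds a hδ)]
    with z hz hza
  have hsub : Set.uIcc (a i) (z i) ⊆ Set.Icc 0 1 :=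
    (convex_Icc (0 : ℝ) 1).ordConnected.uIcc_subset ⟨ha.1 i, ha.2 i⟩ ⟨hz.1 i, hz.2 i⟩
  have hosc : ∀ t ∈ Set.uIcc (a i) (z i), |Ψ L (Function.update z i t) - Ψ L a| < ε / 2 :=
    fun t ht => hδΨ (update_mem_cube hz i (hsub ht)) <| by
      rw [dist_eq_norm]
      exact (norm_update_sub_le ht).trans_lt (mem_ball_iff_norm.1 hza)
  have htaylor := abs_sub_taylor_polynomial_le (L := L)
    (φ := fun l t => Ψ l (Function.update z i t)) (a := a i) (s := z i) (ε := ε)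
    (fun l hl t ht => (hΦ.hasDerivWithinAt_replicate hz hl (hsub ht)).mono hsub)
    fun t ht => by
      have h₁ := abs_lt.1 (hosc t ht)
      have h₂ := abs_lt.1 (hosc (a i) Set.left_mem_uIcc)
      rw [abs_le]
      constructor <;> linarith
  simp only [Function.update_eq_self] at htaylor
  have hzi : |z i - a i| ≤ ‖z - a‖ := norm_le_pi_norm (z - a) i
  rw [norm_pow, norm_norm]
  exact htaylor.trans (by gcongr)

/-- The face through `a` of the closed cube on which only the coordinates in `cs` vary. -/
def cubeFace (a : Fin N → ℝ) (cs : List (Fin N)) : Set (Fin N → ℝ) :=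
  {z ∈ Set.Icc 0 1 | ∀ j, j ∉ cs → z j = a j}

/-- The Taylor polynomial of order `L` at `a` in the coordinates listed in `cs`, with the partial
derivatives taken in the order prescribed by `cs`, the last coordinate first. -/
noncomputable def cubeTaylor (cs : List (Fin N)) (L : ℕ) (Φ : (Fin N → ℝ) → ℝ)
    (a z : Fin N → ℝ) : ℝ :=
  ∑ m ∈ expSet cs L, iterPartial (expWord cs m) Φ a * mono m (z - a)

theorem cubeTaylor_append_singleton {cs : List (Fin N)} (hi : i ∉ cs) :
    cubeTaylor (cs ++ [i]) L Φ a z = ∑ k ∈ Finset.range (L + 1),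
      cubeTaylor cs (L - k) (iterPartial (List.replicate k i) Φ) a (Function.update z i (a i)) *
        ((z i - a i) ^ k / (k.factorial : ℝ)) := by
  simp only [cubeTaylor, sum_expSet_append_singleton hi, Finset.sum_mul]
  refine Finset.sum_congr rfl fun k _ => Finset.sum_congr rfl fun m hm => ?_
  have hmi : m i = 0 := (mem_expSet.1 hm).2 i hi
  rw [expWord_append_singleton_update hi, iterPartial_append, mono_update hmi, mul_assoc,
    mono_congr_of_eq_zero (m := m) (v := z - a) (w := Function.update z i (a i) - a)]
  · rfl
  · intro j hj
    rw [Pi.sub_apply, Pi.sub_apply, Function.update_of_ne (by rintro rfl; exact hj hmi)]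

theorem tendsto_update_cubeFace (ha : a ∈ Set.Icc (0 : Fin N → ℝ) 1) (i : Fin N)
    (cs : List (Fin N)) :
    Tendsto (fun z => Function.update z i (a i)) (𝓝[cubeFace a (cs ++ [i])] a)
      (𝓝[cubeFace a cs] a) := by
  refine tendsto_nhdsWithin_iff.2 ⟨?_, eventually_mem_nhdsWithin.mono fun z hz => ?_⟩
  · have hcont : Continuous fun z : Fin N → ℝ => Function.update z i (a i) := by fun_prop
    exact (hcont.tendsto' a a (Function.update_eq_self i a)).mono_left nhdsWithin_le_nhds
  · refine ⟨update_mem_cube hz.1 i ⟨ha.1 i, ha.2 i⟩, fun j hj => ?_⟩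
    by_cases hji : j = i
    · rw [hji, Function.update_self]
    · rw [Function.update_of_ne hji]
      exact hz.2 j (by simp [hj, hji])

theorem isLittleO_sub_cubeTaylor_append_singleton (ha : a ∈ Set.Icc (0 : Fin N → ℝ) 1)
    {cs : List (Fin N)} (hi : i ∉ cs) (hΦ : IterPartialExists (List.replicate L i) Φ)
    (hcont : ContinuousWithinAt (iterPartial (List.replicate L i) Φ) (Set.Icc 0 1) a)
    (hcs : ∀ k ≤ L, (fun z => iterPartial (List.replicate k i) Φ z -
      cubeTaylor cs (L - k) (iterPartial (List.replicate k i) Φ) a z)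
        =o[𝓝[cubeFace a cs] a] fun z => ‖z - a‖ ^ (L - k)) :
    (fun z => Φ z - cubeTaylor (cs ++ [i]) L Φ a z)
      =o[𝓝[cubeFace a (cs ++ [i])] a] fun z => ‖z - a‖ ^ L := by
  set Ψ : ℕ → (Fin N → ℝ) → ℝ := fun k => iterPartial (List.replicate k i) Φ
  have hcoordinate := (isLittleO_sub_coordinate_taylor ha hΦ hcont).mono
    (nhdsWithin_mono a (Set.sep_subset _ _ : cubeFace a (cs ++ [i]) ⊆ Set.Icc 0 1))
  have hnorm : (fun z => ‖Function.update z i (a i) - a‖) =O[𝓝[cubeFace a (cs ++ [i])] a]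
      fun z => ‖z - a‖ :=
    .of_bound' <| .of_forall fun z => by
      rw [norm_norm, norm_norm]
      exact norm_update_sub_le Set.left_mem_uIcc
  have hpow : ∀ k, (fun z : Fin N → ℝ => (z i - a i) ^ k / (k.factorial : ℝ))
      =O[𝓝[cubeFace a (cs ++ [i])] a] fun z => ‖z - a‖ ^ k := fun k => by
    simp only [div_eq_mul_inv, mul_comm _ (k.factorial : ℝ)⁻¹]
    have hcoord : (fun z : Fin N → ℝ => z i - a i) =O[𝓝[cubeFace a (cs ++ [i])] a]
        fun z => ‖z - a‖ :=
      (IsBigO.of_bound' <| .of_forall fun z => norm_le_pi_norm (z - a) i).norm_right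
    exact (hcoord.pow k).const_mul_left _
  have hterm : ∀ k ∈ Finset.range (L + 1), (fun z => (Ψ k (Function.update z i (a i)) -
      cubeTaylor cs (L - k) (Ψ k) a (Function.update z i (a i))) *
        ((z i - a i) ^ k / (k.factorial : ℝ)))
          =o[𝓝[cubeFace a (cs ++ [i])] a] fun z => ‖z - a‖ ^ L := fun k hk => by
    have hkL : k ≤ L := Nat.lt_succ_iff.1 (Finset.mem_range.1 hk)
    have hΨ := ((hcs k hkL).comp_tendsto (tendsto_update_cubeFace ha i cs)).trans_isBigO
      (hnorm.pow (L - k))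
    simpa only [← pow_add, Nat.sub_add_cancel hkL, Function.comp_def] using hΨ.mul_isBigO (hpow k)
  refine (hcoordinate.add (IsLittleO.fun_sum hterm)).congr_left fun z => ?_
  simp only [cubeTaylor_append_singleton hi, Ψ, sub_mul, Finset.sum_sub_distrib]
  ring

theorem isLittleO_sub_cubeTaylor (ha : a ∈ Set.Icc (0 : Fin N → ℝ) 1) {cs : List (Fin N)}
    (hcs : cs.Nodup)
    (hΦ : ∀ m : Fin N → ℕ, (∀ j, j ∉ cs → m j = 0) → ∑ j, m j = L →
      IterPartialExists (expWord cs m) Φ ∧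
        ContinuousWithinAt (iterPartial (expWord cs m) Φ) (Set.Icc 0 1) a) :
    (fun z => Φ z - cubeTaylor cs L Φ a z) =o[𝓝[cubeFace a cs] a] fun z => ‖z - a‖ ^ L := by
  induction cs using List.reverseRecOn generalizing L Φ with
  | nil =>
    refine (isLittleO_zero _ _).congr' (eventually_mem_nhdsWithin.mono fun z hz => ?_) .rfl
    have hza : z = a := funext fun j => hz.2 j List.not_mem_nil
    simp [hza, cubeTaylor, expSet_nil, expWord, iterPartial, mono_zero]
  | append_singleton cs i ih =>
    obtain ⟨hcs, -, hdisj⟩ := List.nodup_append.1 hcs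
    have hi : i ∉ cs := fun h => hdisj i h i (List.mem_singleton_self i) rfl
    have hsplit : ∀ k ≤ L, ∀ m : Fin N → ℕ, (∀ j, j ∉ cs → m j = 0) → ∑ j, m j = L - k →
        (IterPartialExists (List.replicate k i) Φ ∧
          IterPartialExists (expWord cs m) (iterPartial (List.replicate k i) Φ)) ∧
        ContinuousWithinAt (iterPartial (expWord cs m) (iterPartial (List.replicate k i) Φ))
          (Set.Icc 0 1) a := fun k hk m hm hsum => by
      have hupdate := hΦ (Function.update m i k) (fun j hj => by
        simp only [List.mem_append, List.mem_singleton, not_or] at hj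
        rw [Function.update_of_ne hj.2, hm j hj.1])
        (by rw [sum_update_of_eq_zero (hm i hi)]; omega)
      rwa [expWord_append_singleton_update hi, iterPartialExists_append, iterPartial_append]
        at hupdate
    have htop := hsplit L le_rfl 0 (fun _ _ => rfl) (by simp)
    rw [show expWord cs 0 = [] by simp [expWord]] at htop
    exact isLittleO_sub_cubeTaylor_append_singleton ha hi htop.1.1 htop.2 fun k hk =>
      ih hcs fun m hm hsum => ⟨(hsplit k hk m hm hsum).1.2, (hsplit k hk m hm hsum).2⟩

theorem isLittleO_sub_taylor_multiIdx (ha : a ∈ Set.Icc (0 : Fin N → ℝ) 1)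
    (hΦ : ∀ m : Fin N → ℕ, ∑ j, m j = L → IterPartialExists (multiWord m) Φ ∧
      ContinuousWithinAt (iterPartial (multiWord m) Φ) (Set.Icc 0 1) a) :
    (fun z => Φ z - ∑ m ∈ multiIdx N L, iterPartial (multiWord m) Φ a * mono m (z - a))
      =o[𝓝[Set.Icc 0 1] a] fun z => ‖z - a‖ ^ L := by
  have hface : cubeFace a (List.finRange N) = Set.Icc 0 1 :=
    Set.sep_eq_self_iff_mem_true.2 fun z _ j hj => absurd (List.mem_finRange j) hj
  have htaylor := isLittleO_sub_cubeTaylor ha (List.nodup_finRange N) fun m _ hm => hΦ m hm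
  simpa only [hface, cubeTaylor, expSet_finRange, expWord, multiWord] using htaylor

end Cube

/-! ### Convergence in probability -/

section InProbability

variable {ι Ω : Type*} [MeasurableSpace Ω]

/-- The filter of convergence in probability: a property of `(i, ω)` holds eventually along
`inProbability P u` when its failure has outer `P`-probability tending to `0` as `i` tends to
infinity along `u`. It turns limits in probability into limits along a filter, so that stochastic
expansions can be proved by deterministic arguments. -/
def inProbability (P : Measure Ω) (u : Filter ι) : Filter (ι × Ω) where
  sets := {S | Tendsto (fun i => P {ω | (i, ω) ∉ S}) u (𝓝 0)}
  univ_sets := by simpa using tendsto_const_nhds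
  sets_of_superset {S S'} hS hSS' :=
    tendsto_of_tendsto_of_tendsto_of_le_of_le tendsto_const_nhds hS (fun _ => zero_le)
      fun i => measure_mono fun ω (hω : (i, ω) ∉ S') hωS => hω (hSS' hωS)
  inter_sets {S S'} hS hS' := by
    have hadd : Tendsto (fun i => P {ω | (i, ω) ∉ S} + P {ω | (i, ω) ∉ S'}) u (𝓝 0) := by
      simpa using Tendsto.add hS hS'
    refine tendsto_of_tendsto_of_tendsto_of_le_of_le tendsto_const_nhds hadd (fun _ => zero_le)
      fun i => (measure_mono fun ω hω => ?_).trans (measure_union_le _ _)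
    exact not_and_or.1 hω

variable {P : Measure Ω} {u : Filter ι}

theorem eventually_inProbability_iff {p : ι × Ω → Prop} :
    (∀ᶠ z in inProbability P u, p z) ↔ Tendsto (fun i => P {ω | ¬ p (i, ω)}) u (𝓝 0) :=
  Iff.rfl

theorem tendsto_inProbability_iff {E : Type*} [PseudoMetricSpace E] {T : ι → Ω → E} {t : E} :
    Tendsto (fun z : ι × Ω => T z.1 z.2) (inProbability P u) (𝓝 t) ↔
      TendstoInMeasure P T u fun _ => t := by
  simp only [Metric.tendsto_nhds, tendstoInMeasure_iff_dist, eventually_inProbability_iff, not_lt]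

theorem tendsto_fst_inProbability : Tendsto Prod.fst (inProbability P u) u := fun S hS =>
  eventually_inProbability_iff.2 <| tendsto_const_nhds.congr' <|
    (show ∀ᶠ i in u, i ∈ S from hS).mono fun i hi => by simp [hi]

theorem eventually_inProbability_of_ae {p : Ω → Prop} (hp : ∀ᵐ ω ∂P, p ω) :
    ∀ᶠ z in inProbability P u, p z.2 :=
  eventually_inProbability_iff.2 <| tendsto_const_nhds.congr fun _ => (ae_iff.1 hp).symm

end InProbability

section WeakLaw

variable {Ω : Type*} [MeasurableSpace Ω] {P : Measure Ω}

theorem integral_scaled_average {V : ℕ → Ω → ℝ} {b m : ℝ} {n : ℕ} (hV : ∀ i, Integrable (V i) P)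
    (hm : ∀ i, ∫ ω, V i ω ∂P = m) (hn : n ≠ 0) :
    ∫ ω, 1 / ((n : ℝ) * b) * ∑ i ∈ Finset.range n, V i ω ∂P = m / b := by
  rw [integral_const_mul, integral_finsetSum _ fun i _ => hV i]
  simp only [hm, Finset.sum_const, Finset.card_range, nsmul_eq_mul]
  field_simp

variable [IsProbabilityMeasure P]

theorem tendstoInMeasure_of_tendsto_variance {ι : Type*} {u : Filter ι} {W : ι → Ω → ℝ} {t : ℝ}
    (hW : ∀ i, MemLp (W i) 2 P) (hmean : Tendsto (fun i => P[W i]) u (𝓝 t))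
    (hvar : Tendsto (fun i => variance (W i) P) u (𝓝 0)) :
    TendstoInMeasure P W u fun _ => t := by
  rw [tendstoInMeasure_iff_dist]
  intro ε hε
  have hlim : Tendsto (fun i => ENNReal.ofReal (variance (W i) P / (ε / 2) ^ 2)) u (𝓝 0) := by
    rw [← ENNReal.ofReal_zero]
    exact ENNReal.tendsto_ofReal (by simpa using hvar.div_const ((ε / 2) ^ 2))
  refine tendsto_of_tendsto_of_tendsto_of_le_of_le' tendsto_const_nhds hlim
    (.of_forall fun _ => zero_le) ?_
  filter_upwards [Metric.tendsto_nhds.1 hmean (ε / 2) (half_pos hε)] with i hi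
  refine (measure_mono fun ω (hω : ε ≤ dist (W i ω) t) => ?_).trans
    (meas_ge_le_variance_div_sq (hW i) (half_pos hε))
  rw [Set.mem_ofPred_eq, ← Real.dist_eq]
  linarith [dist_triangle (W i ω) P[W i] t]

theorem variance_le_mul_integral_abs {V : Ω → ℝ} (hV : AEStronglyMeasurable V P) {C : ℝ}
    (hC : ∀ ω, |V ω| ≤ C) : variance V P ≤ C * ∫ ω, |V ω| ∂P := by
  refine (variance_le_expectation_sq hV).trans ?_
  rw [← integral_const_mul]
  refine integral_mono_of_nonneg (.of_forall fun ω => sq_nonneg (V ω))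
    ((Integrable.of_bound hV C (.of_forall hC)).abs.const_mul C) (.of_forall fun ω => ?_)
  rw [Pi.pow_apply, ← sq_abs, sq]
  exact mul_le_mul_of_nonneg_right (hC ω) (abs_nonneg _)

variable {V : ℕ → Ω → ℝ} {b C : ℝ} {n : ℕ}

theorem variance_scaled_average_le {m : ℝ} (hV : ∀ i, AEStronglyMeasurable (V i) P)
    (hC : ∀ i ω, |V i ω| ≤ C) (hind : Pairwise fun i j => IndepFun (V i) (V j) P)
    (hm : ∀ i, ∫ ω, |V i ω| ∂P = m) :
    variance (fun ω => 1 / ((n : ℝ) * b) * ∑ i ∈ Finset.range n, V i ω) P ≤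
      C * (m / b) * ((n : ℝ) * b)⁻¹ := by
  have hsum : variance (fun ω => ∑ i ∈ Finset.range n, V i ω) P =
      ∑ i ∈ Finset.range n, variance (V i) P := by
    rw [← IndepFun.variance_sum (fun i _ => MemLp.of_bound (hV i) C (.of_forall (hC i)))
      fun i _ j _ hij => hind hij, Finset.sum_fn]
  have hle : ∑ i ∈ Finset.range n, variance (V i) P ≤ n * (C * m) := by
    refine (Finset.sum_le_card_nsmul _ _ (C * m) fun i _ => ?_).trans_eq (by simp)
    exact (variance_le_mul_integral_abs (hV i) (hC i)).trans_eq (by rw [hm i])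
  rw [variance_const_mul, hsum]
  refine (mul_le_mul_of_nonneg_left hle (sq_nonneg _)).trans_eq ?_
  rcases eq_or_ne n 0 with rfl | hn
  · simp
  · field_simp

theorem tendstoInMeasure_scaled_average {V : ℕ → ℕ → Ω → ℝ}
    (hV : ∀ n i, AEStronglyMeasurable (V n i) P) (hC : ∀ n i ω, |V n i ω| ≤ C)
    (hind : ∀ n, Pairwise fun i j => IndepFun (V n i) (V n j) P) {m m' b : ℕ → ℝ}
    (hm : ∀ n i, ∫ ω, V n i ω ∂P = m n) (hm' : ∀ n i, ∫ ω, |V n i ω| ∂P = m' n)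
    (hb : Tendsto (fun n : ℕ => (n : ℝ) * b n) atTop atTop) {t t' : ℝ}
    (hmean : Tendsto (fun n => m n / b n) atTop (𝓝 t))
    (habs : Tendsto (fun n => m' n / b n) atTop (𝓝 t')) :
    TendstoInMeasure P
      (fun (n : ℕ) ω => 1 / ((n : ℝ) * b n) * ∑ i ∈ Finset.range n, V n i ω) atTop
      fun _ => t := by
  have hmem : ∀ n i, MemLp (V n i) 2 P := fun n i => .of_bound (hV n i) C (.of_forall (hC n i))
  refine tendstoInMeasure_of_tendsto_variance
    (fun n => (memLp_finsetSum _ fun i _ => hmem n i).const_mul _) (hmean.congr' ?_) ?_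
  · filter_upwards [eventually_ne_atTop 0] with n hn
    exact (integral_scaled_average (fun i => (hmem n i).integrable one_le_two) (hm n) hn).symm
  · have hlim := (habs.const_mul C).mul hb.inv_tendsto_atTop
    rw [mul_zero] at hlim
    exact tendsto_of_tendsto_of_tendsto_of_le_of_le tendsto_const_nhds hlim
      (fun _ => variance_nonneg _ _)
      fun n => variance_scaled_average_le (hV n) (hC n) (hind n) (hm' n)

end WeakLaw

/-! ### Rescaling at a point of a closed set -/

section Rescaling

variable {E : Type*} [NormedAddCommGroup E] [NormedSpace ℝ E] {x : E} {C D : Set E}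
  {w φ : E → ℝ}

theorem tendsto_indicator_rescaled
    (hCD : ∀ v, ∀ᶠ h in 𝓝[>] (0 : ℝ), (x + h • v ∈ C ↔ v ∈ D)) (hw : ContinuousWithinAt w C x)
    (v : E) :
    Tendsto (fun h : ℝ => {v | x + h • v ∈ C}.indicator (fun v => φ v * w (x + h • v)) v)
      (𝓝[>] 0) (𝓝 (D.indicator (fun v => φ v * w x) v)) := by
  by_cases hv : v ∈ D
  · have hin : ∀ᶠ h in 𝓝[>] (0 : ℝ), x + h • v ∈ C := (hCD v).mono fun h hh => hh.2 hv
    have hpath : Tendsto (fun h : ℝ => x + h • v) (𝓝[>] 0) (𝓝[C] x) :=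
      tendsto_nhdsWithin_iff.2 ⟨((by fun_prop : Continuous fun h : ℝ => x + h • v).tendsto' 0 x
        (by simp)).mono_left nhdsWithin_le_nhds, hin⟩
    rw [Set.indicator_of_mem hv]
    refine ((hw.tendsto.comp hpath).const_mul (φ v)).congr' ?_
    filter_upwards [hin] with h hh
    exact (Set.indicator_of_mem (s := {v | x + h • v ∈ C}) hh fun v => φ v * w (x + h • v)).symm
  · rw [Set.indicator_of_notMem hv]
    refine Tendsto.congr' ?_ tendsto_const_nhds
    filter_upwards [hCD v] with h hh
    exact (Set.indicator_of_notMem (s := {v | x + h • v ∈ C}) (fun hc => hv (hh.1 hc))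
      fun v => φ v * w (x + h • v)).symm

variable [MeasurableSpace E] [BorelSpace E]

theorem measurableSet_setOf_add_smul_mem (hC : MeasurableSet C) (x : E) (h : ℝ) :
    MeasurableSet {v : E | x + h • v ∈ C} :=
  (by fun_prop : Continuous fun v : E => x + h • v).measurable hC

theorem setIntegral_eq_rescaled [FiniteDimensional ℝ E] (vol : Measure E) [vol.IsAddHaarMeasure]
    (hC : MeasurableSet C) (F : E → ℝ) (x : E) {h : ℝ} (hh : 0 < h) :
    ∫ s in C, F s ∂vol =
      h ^ Module.finrank ℝ E * ∫ v in {v : E | x + h • v ∈ C}, F (x + h • v) ∂vol := by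
  have key := Measure.integral_comp_smul vol (fun v => C.indicator F (x + v)) h
  rw [integral_add_left_eq_self (μ := vol) (fun v => C.indicator F v) x] at key
  have hind : ({v : E | x + h • v ∈ C}.indicator fun v => F (x + h • v)) =
      fun v => C.indicator F (x + h • v) := by
    ext v; simp [Set.indicator]
  rw [← integral_indicator hC, ← integral_indicator (measurableSet_setOf_add_smul_mem hC x h),
    hind, key, abs_of_pos (by positivity), smul_eq_mul, ← mul_assoc,
    mul_inv_cancel₀ (by positivity), one_mul]

theorem tendsto_setIntegral_rescaled (vol : Measure E) [IsFiniteMeasureOnCompacts vol]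
    (hC : IsCompact C) (hD : MeasurableSet D)
    (hx : x ∈ C) (hCD : ∀ v, ∀ᶠ h in 𝓝[>] (0 : ℝ), (x + h • v ∈ C ↔ v ∈ D))
    (hw : ContinuousOn w C) (hφ : Continuous φ) (hφs : HasCompactSupport φ) :
    Tendsto (fun h : ℝ => ∫ v in {v : E | x + h • v ∈ C}, φ v * w (x + h • v) ∂vol) (𝓝[>] 0)
      (𝓝 (w x * ∫ v in D, φ v ∂vol)) := by
  obtain ⟨B, hB⟩ := hC.exists_bound_of_continuousOn hw
  have hB0 : 0 ≤ B := (norm_nonneg _).trans (hB x hx)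
  have hmeas := measurableSet_setOf_add_smul_mem hC.measurableSet x
  have hlim : w x * ∫ v in D, φ v ∂vol = ∫ v, D.indicator (fun v => φ v * w x) v ∂vol := by
    rw [integral_indicator hD, integral_mul_const, mul_comm]
  simp_rw [hlim, ← integral_indicator (hmeas _)]
  refine tendsto_integral_filter_of_dominated_convergence (fun v => |φ v| * B)
    (.of_forall fun h => ?_) (.of_forall fun h => .of_forall fun v => ?_)
    ((hφ.integrable_of_hasCompactSupport hφs).abs.mul_const B)
    (.of_forall fun v => tendsto_indicator_rescaled hCD (hw x hx) v)
  · rw [aestronglyMeasurable_indicator_iff (hmeas h)]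
    refine ContinuousOn.aestronglyMeasurable ?_ (hmeas h)
    exact hφ.continuousOn.mul (hw.comp (by fun_prop) fun v hv => hv)
  · by_cases hv : x + h • v ∈ C
    · rw [Set.indicator_of_mem (by exact hv), norm_mul]
      exact mul_le_mul_of_nonneg_left (hB _ hv) (norm_nonneg _)
    · rw [Set.indicator_of_notMem (by exact hv), norm_zero]
      positivity

end Rescaling

/-! ### Gram matrices -/

section Gram

variable {E κ : Type*} [Fintype κ] {b : κ → E → ℝ} {ω : E → ℝ}

theorem dotProduct_mulVec_gram [MeasurableSpace E] {ρ : Measure E}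
    (hint : ∀ a a', Integrable (fun v => b a v * (b a' v * ω v)) ρ) (c : κ → ℝ) :
    c ⬝ᵥ (Matrix.of fun a a' => ∫ v, b a v * (b a' v * ω v) ∂ρ).mulVec c =
      ∫ v, (∑ a, c a * b a v) ^ 2 * ω v ∂ρ := by
  have hexpand : ∀ v, (∑ a, c a * b a v) ^ 2 * ω v =
      ∑ a, c a * ∑ a', b a v * (b a' v * ω v) * c a' := fun v => by
    rw [sq, Finset.sum_mul_sum, Finset.sum_mul]
    refine Finset.sum_congr rfl fun a _ => ?_
    rw [Finset.sum_mul, Finset.mul_sum]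
    exact Finset.sum_congr rfl fun a' _ => by ring
  have hint' := fun a a' => (hint a a').mul_const (c a')
  simp_rw [hexpand]
  rw [integral_finsetSum _ fun a _ => (integrable_finsetSum _ fun a' _ => hint' a a').const_mul _]
  simp_rw [integral_const_mul, integral_finsetSum _ fun a' _ => hint' _ a', integral_mul_const]
  rfl

variable [TopologicalSpace E] [MeasurableSpace E] {D : Set E} {v₀ : E}

theorem eventually_eq_zero_of_setIntegral_sq_mul_eq_zero (vol : Measure E) [vol.IsOpenPosMeasure]
    {s : E → ℝ} (hs : Continuous s) (hω : Continuous ω) (hω0 : ∀ v, 0 ≤ ω v)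
    (hint : IntegrableOn (fun v => s v ^ 2 * ω v) D vol)
    (hv₀ : ∀ᶠ v in 𝓝 v₀, v ∈ D ∧ 0 < ω v) (hzero : ∫ v in D, s v ^ 2 * ω v ∂vol = 0) :
    ∀ᶠ v in 𝓝 v₀, s v = 0 := by
  rw [integral_eq_zero_iff_of_nonneg (fun v => mul_nonneg (sq_nonneg _) (hω0 v)) hint] at hzero
  obtain ⟨U, hU, hUo, hvU⟩ := eventually_nhds_iff.1 hv₀
  have hUD : U ⊆ D := fun v hv => (hU v hv).1
  have hzeroU := Measure.eqOn_open_of_ae_eq (ae_restrict_of_ae_restrict_of_subset hUD hzero) hUo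
    ((hs.pow 2).mul hω).continuousOn continuousOn_const
  filter_upwards [hUo.mem_nhds hvU] with v hv
  exact pow_eq_zero_iff two_ne_zero |>.1 ((mul_eq_zero.1 (hzeroU hv)).resolve_right (hU v hv).2.ne')

theorem det_gram_ne_zero [OpensMeasurableSpace E] [DecidableEq κ] (vol : Measure E)
    [IsFiniteMeasureOnCompacts vol] [vol.IsOpenPosMeasure] (hb : ∀ a, Continuous (b a))
    (hω : Continuous ω) (hωs : HasCompactSupport ω) (hω0 : ∀ v, 0 ≤ ω v)
    (hv₀ : ∀ᶠ v in 𝓝 v₀, v ∈ D ∧ 0 < ω v)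
    (hlin : ∀ c : κ → ℝ, (∀ᶠ v in 𝓝 v₀, ∑ a, c a * b a v = 0) → c = 0) :
    (Matrix.of fun a a' => ∫ v in D, b a v * (b a' v * ω v) ∂vol).det ≠ 0 := by
  intro hdet
  obtain ⟨c, hc, hc0⟩ := Matrix.exists_mulVec_eq_zero_iff.2 hdet
  have hs : Continuous fun v => ∑ a, c a * b a v :=
    continuous_finsetSum _ fun a _ => (hb a).const_mul (c a)
  refine hc (hlin c (eventually_eq_zero_of_setIntegral_sq_mul_eq_zero vol hs hω hω0 ?_ hv₀ ?_))
  · exact (((hs.pow 2).mul hω).integrable_of_hasCompactSupport hωs.mul_left).integrableOn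
  · rw [← dotProduct_mulVec_gram _ c, hc0, dotProduct_zero]
    exact fun a a' => (((hb a).mul ((hb a').mul hω)).integrable_of_hasCompactSupport
      hωs.mul_left.mul_left).integrableOn

end Gram

theorem polynomial_eq_zero_of_eventually_eval_eq_zero {Q : Polynomial ℝ} {v₀ : ℝ}
    (hQ : ∀ᶠ v in 𝓝 v₀, Q.eval v = 0) : Q = 0 := by
  obtain ⟨ε, hε, hball⟩ := Metric.eventually_nhds_iff_ball.1 hQ
  refine Q.eq_zero_of_infinite_isRoot (Set.Infinite.mono hball ?_)
  rw [Real.ball_eq_Ioo]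
  exact Set.Ioo_infinite (by linarith)

theorem mvPolynomial_eq_zero_of_eventually_eval_eq_zero {d : ℕ} {Q : MvPolynomial (Fin d) ℝ}
    {v₀ : Fin d → ℝ} (hQ : ∀ᶠ v in 𝓝 v₀, MvPolynomial.eval v Q = 0) : Q = 0 := by
  obtain ⟨ε, hε, hball⟩ := Metric.eventually_nhds_iff_ball.1 hQ
  refine MvPolynomial.funext_set (fun j => Metric.ball (v₀ j) ε) (fun j => ?_) fun v hv => ?_
  · rw [Real.ball_eq_Ioo]
    exact Set.Ioo_infinite (by linarith)
  · rw [map_zero, hball v (by rwa [ball_pi _ hε])]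

theorem eq_zero_of_eventually_sum_mul_pVec_eq_zero {p : ℕ} {v₀ : ℝ} {c : Fin (p + 1) → ℝ}
    (hc : ∀ᶠ v in 𝓝 v₀, ∑ a, c a * pVec p v a = 0) : c = 0 := by
  set Q : Polynomial ℝ := ∑ a : Fin (p + 1),
    Polynomial.monomial (a : ℕ) (c a / ((a : ℕ).factorial : ℝ)) with hQ
  have hQ0 : Q = 0 := by
    refine polynomial_eq_zero_of_eventually_eval_eq_zero (v₀ := v₀) ?_
    filter_upwards [hc] with v hv
    rw [← hv, hQ, Polynomial.eval_finsetSum]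
    exact Finset.sum_congr rfl fun a _ => by rw [Polynomial.eval_monomial, pVec]; ring
  ext a
  have hcoeff : Q.coeff a = c a / ((a : ℕ).factorial : ℝ) := by
    rw [hQ, Polynomial.finsetSum_coeff, Finset.sum_eq_single a]
    · simp
    · intro b _ hb
      rw [Polynomial.coeff_monomial, if_neg fun h => hb (Fin.ext h)]
    · simp
  rw [hQ0, Polynomial.coeff_zero, eq_comm, div_eq_zero_iff] at hcoeff
  exact hcoeff.resolve_right (by positivity)

theorem eq_zero_of_eventually_sum_mul_qVec_eq_zero {d q : ℕ} {v₀ : Fin d → ℝ}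
    {c : multiIdx d q → ℝ} (hc : ∀ᶠ v in 𝓝 v₀, ∑ a, c a * qVec q v a = 0) : c = 0 := by
  set Q : MvPolynomial (Fin d) ℝ := ∑ a : multiIdx d q,
    MvPolynomial.monomial (Finsupp.equivFunOnFinite.symm a.1)
      (c a / ∏ j, ((a.1 j).factorial : ℝ)) with hQ
  have hQ0 : Q = 0 := by
    refine mvPolynomial_eq_zero_of_eventually_eval_eq_zero (v₀ := v₀) ?_
    filter_upwards [hc] with v hv
    rw [← hv, hQ, map_sum]
    refine Finset.sum_congr rfl fun a _ => ?_
    rw [MvPolynomial.eval_monomial, Finsupp.prod_fintype _ _ (by simp)]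
    simp only [qVec, mono, Finsupp.equivFunOnFinite_symm_apply_apply, Finset.prod_div_distrib]
    ring
  ext a
  have hcoeff : Q.coeff (Finsupp.equivFunOnFinite.symm a.1) =
      c a / ∏ j, ((a.1 j).factorial : ℝ) := by
    rw [hQ, MvPolynomial.coeff_sum, Finset.sum_eq_single a]
    · simp
    · intro b _ hb
      rw [MvPolynomial.coeff_monomial, if_neg]
      exact fun h => hb (Subtype.ext (Finsupp.equivFunOnFinite.symm.injective h))
    · simp
  rw [hQ0, MvPolynomial.coeff_zero, eq_comm, div_eq_zero_iff] at hcoeff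
  exact hcoeff.resolve_right (by positivity)

/-! ### Extracting a coefficient with the inverse moment matrix -/

/-- `c` converges along `l` to some nonzero multiple of `c₀`. Extraction weights are invariant
under rescaling of the moments, so this determines their limits. -/
def TendstoMultiple {ι E : Type*} [TopologicalSpace E] [SMul ℝ E] (c : ι → E) (l : Filter ι)
    (c₀ : E) : Prop :=
  ∃ r : ℝ, r ≠ 0 ∧ Tendsto c l (𝓝 (r • c₀))

section Extraction

variable {ι J κ : Type*} {e : κ → J} {c : J → κ → ℝ} {l : Filter ι} {u : ι → J → κ → ℝ}

/-- The square matrix whose row `a` is the moment vector `c (e a)`. The exponents of a polynomial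
basis are listed by `e`, and `c k` collects the moments of the monomial with exponent `k` against
the elements of the weighted basis, so `S_y`, `S_x` and their sample versions have this form. -/
def momentMatrix (e : κ → J) (c : J → κ → ℝ) : Matrix κ κ ℝ :=
  Matrix.of fun a => c (e a)

theorem continuous_momentMatrix (e : κ → J) : Continuous (momentMatrix e) :=
  continuous_pi fun a => continuous_apply (e a)

variable [Fintype κ] [DecidableEq κ]

theorem det_momentMatrix_smul_ne_zero (hdet : (momentMatrix e c).det ≠ 0) {r : ℝ} (hr : r ≠ 0) :
    (momentMatrix e (r • c)).det ≠ 0 := by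
  change (r • momentMatrix e c).det ≠ 0
  rw [det_smul]
  exact mul_ne_zero (pow_ne_zero _ hr) hdet

theorem continuousAt_inv_momentMatrix (hdet : (momentMatrix e c).det ≠ 0) :
    ContinuousAt (fun c => (momentMatrix e c)⁻¹) c := by
  refine (continuousAt_matrix_inv _ ?_).comp (continuous_momentMatrix e).continuousAt
  rw [Ring.inverse_eq_inv']
  exact continuousAt_inv₀ hdet

theorem TendstoMultiple.eventually_det_ne_zero (hu : TendstoMultiple u l c)
    (hdet : (momentMatrix e c).det ≠ 0) : ∀ᶠ i in l, (momentMatrix e (u i)).det ≠ 0 := by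
  obtain ⟨r, hr, hur⟩ := hu
  exact (((continuous_momentMatrix e).matrix_det.tendsto _).comp hur).eventually_ne
    (det_momentMatrix_smul_ne_zero hdet hr)

theorem TendstoMultiple.isBigO_inv_momentMatrix (hu : TendstoMultiple u l c)
    (hdet : (momentMatrix e c).det ≠ 0) (a b : κ) :
    (fun i => (momentMatrix e (u i))⁻¹ a b) =O[l] fun _ => (1 : ℝ) := by
  obtain ⟨r, hr, hur⟩ := hu
  have hinv := (continuousAt_inv_momentMatrix (det_momentMatrix_smul_ne_zero hdet hr)).tendsto
  exact (tendsto_pi_nhds.1 (tendsto_pi_nhds.1 (hinv.comp hur) a) b).isBigO_one ℝ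

variable [DecidableEq J]

/-- `c_kᵀ S⁻¹ e_{j₀}`: how much of the coefficient with exponent `k` the local polynomial fit
attributes to the coefficient with exponent `j₀`. -/
noncomputable def extractionWeight (e : κ → J) (c : J → κ → ℝ) (j₀ k : J) : ℝ :=
  c k ⬝ᵥ (momentMatrix e c)⁻¹ *ᵥ fun a => if e a = j₀ then 1 else 0

theorem extractionWeight_apply (hdet : (momentMatrix e c).det ≠ 0) (j₀ : J) (a : κ) :
    extractionWeight e c j₀ (e a) = if e a = j₀ then 1 else 0 := by
  change (momentMatrix e c *ᵥ (momentMatrix e c)⁻¹ *ᵥ _) a = _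
  rw [mulVec_mulVec, mul_nonsing_inv _ hdet.isUnit, one_mulVec]

theorem extractionWeight_smul (hdet : (momentMatrix e c).det ≠ 0) {r : ℝ} (hr : r ≠ 0) (j₀ k : J) :
    extractionWeight e (r • c) j₀ k = extractionWeight e c j₀ k := by
  have hinv : (momentMatrix e (r • c))⁻¹ = r⁻¹ • (momentMatrix e c)⁻¹ :=
    inv_smul' _ (Units.mk0 r hr) hdet.isUnit
  rw [extractionWeight, hinv, Pi.smul_apply, smul_mulVec, smul_dotProduct, dotProduct_smul,
    smul_inv_smul₀ hr, extractionWeight]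

theorem continuousAt_extractionWeight (hdet : (momentMatrix e c).det ≠ 0) (j₀ k : J) :
    ContinuousAt (fun c => extractionWeight e c j₀ k) c := by
  have hcont : Continuous fun z : (κ → ℝ) × Matrix κ κ ℝ =>
      z.1 ⬝ᵥ z.2 *ᵥ fun a => if e a = j₀ then 1 else 0 :=
    continuous_fst.dotProduct (continuous_snd.matrix_mulVec continuous_const)
  exact hcont.continuousAt.comp
    ((continuous_apply k).continuousAt.prodMk (continuousAt_inv_momentMatrix hdet))

theorem TendstoMultiple.extractionWeight (hu : TendstoMultiple u l c)
    (hdet : (momentMatrix e c).det ≠ 0) (j₀ k : J) :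
    Tendsto (fun i => extractionWeight e (u i) j₀ k) l (𝓝 (extractionWeight e c j₀ k)) := by
  obtain ⟨r, hr, hur⟩ := hu
  rw [← extractionWeight_smul hdet hr]
  exact (continuousAt_extractionWeight (det_momentMatrix_smul_ne_zero hdet hr) j₀ k).tendsto.comp
    hur

end Extraction

/-! ### Kernels and tangent cones -/

/-- A smoothing kernel in the sense of `IsKernelFun`, without normalization and with continuity in
place of the Lipschitz condition: nonnegative, symmetric, continuous, nonzero, supported on
`[-1,1]`. -/
structure IsContinuousKernel (K : ℝ → ℝ) : Prop where
  nonneg : ∀ u, 0 ≤ K u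
  symmetric : ∀ u, K (-u) = K u
  support : Function.support K ⊆ Set.Icc (-1) 1
  continuous : Continuous K
  ne_zero : K ≠ 0

theorem IsKernelFun.isContinuousKernel {K : ℝ → ℝ} (hK : IsKernelFun K) :
    IsContinuousKernel K where
  nonneg := hK.nonneg
  symmetric := hK.symmetric
  support := hK.support
  continuous := hK.lipschitz.elim fun _ hC => hC.continuous
  ne_zero := by
    rintro rfl
    simpa using hK.integral_one

theorem continuous_mono {d : ℕ} (m : Fin d → ℕ) : Continuous (mono m) := by
  unfold mono
  fun_prop

/-- The tangent cone of `[0,1]` at `y`. -/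
def tangentConeIcc (y : ℝ) : Set ℝ := {v | (y = 0 → 0 ≤ v) ∧ (y = 1 → v ≤ 0)}

/-- The tangent cone of `[0,1]^d` at `x`. -/
def tangentConeCube {d : ℕ} (x : Fin d → ℝ) : Set (Fin d → ℝ) :=
  Set.univ.pi fun j => tangentConeIcc (x j)

theorem measurableSet_tangentConeIcc (y : ℝ) : MeasurableSet (tangentConeIcc y) := by
  refine MeasurableSet.inter (s₁ := {v | y = 0 → 0 ≤ v}) (s₂ := {v | y = 1 → v ≤ 0}) ?_ ?_
  · by_cases h : y = 0
    · simpa only [h, true_imp_iff] using! (measurableSet_Ici : MeasurableSet (Set.Ici (0 : ℝ)))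
    · simp [h]
  · by_cases h : y = 1
    · simpa only [h, true_imp_iff] using! (measurableSet_Iic : MeasurableSet (Set.Iic (0 : ℝ)))
    · simp [h]

theorem measurableSet_tangentConeCube {d : ℕ} (x : Fin d → ℝ) :
    MeasurableSet (tangentConeCube x) :=
  MeasurableSet.univ_pi fun j => measurableSet_tangentConeIcc (x j)

theorem eventually_nonneg_add_mul_iff {y : ℝ} (hy : 0 ≤ y) (v : ℝ) :
    ∀ᶠ h in 𝓝[>] (0 : ℝ), (0 ≤ y + h * v ↔ (y = 0 → 0 ≤ v)) := by
  rcases hy.eq_or_lt with rfl | hy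
  · filter_upwards [self_mem_nhdsWithin] with h hh
    simp [mul_nonneg_iff_of_pos_left (show 0 < h from hh)]
  · have hlim : Tendsto (fun h : ℝ => y + h * v) (𝓝[>] 0) (𝓝 y) :=
      ((by fun_prop : Continuous fun h : ℝ => y + h * v).tendsto' 0 y (by simp)).mono_left
        nhdsWithin_le_nhds
    filter_upwards [hlim.eventually_const_lt hy] with h hh
    simp [hh.le, hy.ne']

theorem eventually_mem_Icc_iff {y : ℝ} (hy : y ∈ Set.Icc (0 : ℝ) 1) (v : ℝ) :
    ∀ᶠ h in 𝓝[>] (0 : ℝ), (y + h * v ∈ Set.Icc (0 : ℝ) 1 ↔ v ∈ tangentConeIcc y) := by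
  filter_upwards [eventually_nonneg_add_mul_iff hy.1 v,
    eventually_nonneg_add_mul_iff (sub_nonneg.2 hy.2) (-v)] with h h0 h1
  refine and_congr h0 ?_
  rw [← sub_nonneg, show 1 - (y + h * v) = 1 - y + h * -v by ring, h1, sub_eq_zero, eq_comm,
    neg_nonneg]

theorem eventually_mem_cube_iff {d : ℕ} {x : Fin d → ℝ} (hx : x ∈ Set.Icc (0 : Fin d → ℝ) 1)
    (v : Fin d → ℝ) :
    ∀ᶠ h in 𝓝[>] (0 : ℝ),
      (x + h • v ∈ Set.Icc (0 : Fin d → ℝ) 1 ↔ v ∈ tangentConeCube x) := by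
  rw [← Set.pi_univ_Icc, Set.mem_univ_pi] at hx
  filter_upwards [eventually_all.2 fun j => eventually_mem_Icc_iff (hx j) (v j)] with h hh
  rw [← Set.pi_univ_Icc, tangentConeCube, Set.mem_univ_pi, Set.mem_univ_pi]
  exact forall_congr' hh

namespace IsContinuousKernel

variable {K : ℝ → ℝ} (hK : IsContinuousKernel K)
include hK

theorem eq_zero_of_one_lt_abs {u : ℝ} (hu : 1 < |u|) : K u = 0 := by
  by_contra h
  exact (abs_le.2 (hK.support h)).not_gt hu

theorem hasCompactSupport : HasCompactSupport K :=
  HasCompactSupport.of_support_subset_isCompact isCompact_Icc hK.support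

theorem continuous_PVec (p : ℕ) (a : Fin (p + 1)) : Continuous fun u => PVec K p u a := by
  have := hK.continuous
  unfold PVec pVec
  fun_prop

theorem PVec_eq_zero {p : ℕ} {a : Fin (p + 1)} {u : ℝ} (hu : 1 < |u|) : PVec K p u a = 0 := by
  simp [PVec, hK.eq_zero_of_one_lt_abs hu]

theorem hasCompactSupport_PVec (p : ℕ) (a : Fin (p + 1)) :
    HasCompactSupport fun u => PVec K p u a :=
  hK.hasCompactSupport.mul_left

theorem continuous_prodKernel (d : ℕ) : Continuous (prodKernel (d := d) K) := by
  have := hK.continuous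
  unfold prodKernel
  fun_prop

theorem prodKernel_nonneg {d : ℕ} (v : Fin d → ℝ) : 0 ≤ prodKernel K v :=
  Finset.prod_nonneg fun j _ => hK.nonneg (v j)

theorem prodKernel_eq_zero {d : ℕ} {v : Fin d → ℝ} (hv : 1 < ‖v‖) : prodKernel K v = 0 := by
  obtain ⟨j, hj⟩ : ∃ j, 1 < |v j| := by
    by_contra! h
    exact ((pi_norm_le_iff_of_nonneg zero_le_one).2 h).not_gt hv
  exact Finset.prod_eq_zero (Finset.mem_univ j) (hK.eq_zero_of_one_lt_abs hj)

theorem hasCompactSupport_prodKernel (d : ℕ) : HasCompactSupport (prodKernel (d := d) K) := by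
  refine HasCompactSupport.of_support_subset_isCompact (isCompact_closedBall 0 1) fun v hv => ?_
  rw [mem_closedBall_zero_iff]
  exact not_lt.1 fun h => hv (hK.prodKernel_eq_zero h)

theorem continuous_QVec {d : ℕ} (q : ℕ) (b : multiIdx d q) : Continuous fun v => QVec K q v b :=
  (continuous_mono b.1).mul (hK.continuous_prodKernel d)

theorem QVec_eq_zero {d q : ℕ} {b : multiIdx d q} {v : Fin d → ℝ} (hv : 1 < ‖v‖) :
    QVec K q v b = 0 := by
  simp [QVec, hK.prodKernel_eq_zero hv]

theorem hasCompactSupport_QVec {d : ℕ} (q : ℕ) (b : multiIdx d q) :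
    HasCompactSupport fun v => QVec K q v b :=
  (hK.hasCompactSupport_prodKernel d).mul_left

theorem exists_pos : ∃ u, 0 < u ∧ 0 < K u := by
  obtain ⟨u, hu⟩ := Function.ne_iff.1 hK.ne_zero
  have hnear : ∀ᶠ v in 𝓝 |u|, 0 < K v := by
    refine hK.continuous.continuousAt.eventually_const_lt ?_
    rcases abs_choice u with h | h <;> rw [h]
    · exact (hK.nonneg u).lt_of_ne hu.symm
    · rw [hK.symmetric]
      exact (hK.nonneg u).lt_of_ne hu.symm
  obtain ⟨v, hv, huv⟩ :=
    ((hnear.filter_mono nhdsWithin_le_nhds).and (self_mem_nhdsWithin (s := Set.Ioi |u|))).exists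
  exact ⟨v, (abs_nonneg u).trans_lt huv, hv⟩

theorem exists_eventually_mem_tangentConeIcc_and_pos (y : ℝ) :
    ∃ v₀, ∀ᶠ v in 𝓝 v₀, v ∈ tangentConeIcc y ∧ 0 < K v := by
  obtain ⟨u, hu, hKu⟩ := hK.exists_pos
  by_cases h : y = 1
  · refine ⟨-u, ?_⟩
    filter_upwards [hK.continuous.continuousAt.eventually_const_lt
      (by rwa [hK.symmetric] : 0 < K (-u)), eventually_lt_nhds (neg_neg_of_pos hu)] with v hv hv0
    exact ⟨⟨fun h0 => absurd (h0.symm.trans h) zero_ne_one, fun _ => hv0.le⟩, hv⟩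
  · refine ⟨u, ?_⟩
    filter_upwards [hK.continuous.continuousAt.eventually_const_lt hKu, eventually_gt_nhds hu]
      with v hv hv0
    exact ⟨⟨fun _ => hv0.le, fun h1 => absurd h1 h⟩, hv⟩

theorem exists_eventually_mem_tangentConeCube_and_pos {d : ℕ} (x : Fin d → ℝ) :
    ∃ v₀, ∀ᶠ v in 𝓝 v₀, v ∈ tangentConeCube x ∧ 0 < prodKernel K v := by
  choose v₀ hv₀ using fun j => hK.exists_eventually_mem_tangentConeIcc_and_pos (x j)
  refine ⟨v₀, ?_⟩
  filter_upwards [eventually_all.2 fun j =>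
    ((continuous_apply j).tendsto v₀).eventually (hv₀ j)] with v hv
  exact ⟨fun j _ => (hv j).1, Finset.prod_pos fun j _ => (hv j).2⟩

end IsContinuousKernel

/-- The limit of `c_{y,k}` per unit of density: `∫ (u^k/k!) P(u) du` over the tangent cone. -/
noncomputable def coneMomentIcc (K : ℝ → ℝ) (p : ℕ) (y : ℝ) (k : ℕ) : Fin (p + 1) → ℝ :=
  fun a => ∫ u in tangentConeIcc y, u ^ k / (k.factorial : ℝ) * PVec K p u a

/-- The limit of `c_{x,m}` per unit of density: `∫ (v^m/m!) Q(v) dv` over the tangent cone. -/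
noncomputable def coneMomentCube {d : ℕ} (K : ℝ → ℝ) (q : ℕ) (x : Fin d → ℝ) (m : Fin d → ℕ) :
    multiIdx d q → ℝ :=
  fun b => ∫ v in tangentConeCube x, mono m v * QVec K q v b

namespace IsContinuousKernel

variable {K : ℝ → ℝ} (hK : IsContinuousKernel K)
include hK

theorem det_momentMatrix_coneMomentIcc_ne_zero (p : ℕ) (y : ℝ) :
    (momentMatrix Fin.val (coneMomentIcc K p y)).det ≠ 0 := by
  obtain ⟨v₀, hv₀⟩ := hK.exists_eventually_mem_tangentConeIcc_and_pos y
  exact det_gram_ne_zero volume (b := fun a u => pVec p u a)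
    (fun a => (continuous_id.pow _).div_const _) hK.continuous
    hK.hasCompactSupport hK.nonneg hv₀ fun c hc => eq_zero_of_eventually_sum_mul_pVec_eq_zero hc

theorem det_momentMatrix_coneMomentCube_ne_zero {d : ℕ} (q : ℕ) (x : Fin d → ℝ) :
    (momentMatrix Subtype.val (coneMomentCube K q x)).det ≠ 0 := by
  obtain ⟨v₀, hv₀⟩ := hK.exists_eventually_mem_tangentConeCube_and_pos x
  exact det_gram_ne_zero volume (b := fun a v => qVec q v a) (fun a => continuous_mono a.1)
    (hK.continuous_prodKernel d) (hK.hasCompactSupport_prodKernel d) hK.prodKernel_nonneg hv₀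
    fun c hc => eq_zero_of_eventually_sum_mul_qVec_eq_zero hc

end IsContinuousKernel

/-! ### Sampling from a density on the cube -/

theorem continuousOn_setIntegral {A B : Type*} [TopologicalSpace A] [T2Space A]
    [MeasurableSpace A] [OpensMeasurableSpace A] [SecondCountableTopologyEither A ℝ]
    [TopologicalSpace B] [FirstCountableTopology B] {vol : Measure A}
    [IsFiniteMeasureOnCompacts vol] {CA : Set A} {CB : Set B} {f : A → B → ℝ}
    (hCA : IsCompact CA) (hCB : IsCompact CB)
    (hf : ContinuousOn (fun z : A × B => f z.1 z.2) (CA ×ˢ CB)) :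
    ContinuousOn (fun b => ∫ a in CA, f a b ∂vol) CB := by
  obtain ⟨M, hM⟩ := (hCA.prod hCB).exists_bound_of_continuousOn hf
  have : IsFiniteMeasure (vol.restrict CA) := ⟨by simpa using hCA.measure_lt_top⟩
  intro b hb
  refine continuousWithinAt_of_dominated (bound := fun _ => M) ?_ ?_ (integrable_const M) ?_
  · filter_upwards [self_mem_nhdsWithin] with b' hb'
    exact (hf.comp (f := fun a => (a, b')) (by fun_prop)
      fun a ha => ⟨ha, hb'⟩).aestronglyMeasurable hCA.measurableSet
  · filter_upwards [self_mem_nhdsWithin] with b' hb'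
    filter_upwards [ae_restrict_mem hCA.measurableSet] with a ha
    exact hM (a, b') ⟨ha, hb'⟩
  · filter_upwards [ae_restrict_mem hCA.measurableSet] with a ha
    exact (hf (a, b) ⟨ha, hb⟩).comp (f := fun b' => (a, b')) (by fun_prop)
      fun b' hb' => ⟨ha, hb'⟩

/-- Marginal density of the response, `f_y(y) = ∫_{[0,1]^d} f(y, x) dx`. -/
noncomputable def marginalY {d : ℕ} (f : ℝ → (Fin d → ℝ) → ℝ) (y : ℝ) : ℝ :=
  ∫ x in Set.Icc (0 : Fin d → ℝ) 1, f y x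

/-- A random sample `(Y i, X i)` from a distribution on `[0,1] × [0,1]^d` whose joint Lebesgue
density `f` is continuous and bounded away from zero on that cube: the part of `IsDGP` that does
not concern the derivatives of the conditional distribution function. -/
structure IsCubeSample {Ω : Type*} [MeasurableSpace Ω] (P : Measure Ω) {d : ℕ}
    (Y : ℕ → Ω → ℝ) (X : ℕ → Ω → Fin d → ℝ) (f : ℝ → (Fin d → ℝ) → ℝ) : Prop where
  measurable_Y : ∀ i, Measurable (Y i)
  measurable_X : ∀ i, Measurable (X i)
  indep : iIndepFun (fun i ω => (Y i ω, X i ω)) P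
  law : ∀ i, P.map (fun ω => (Y i ω, X i ω)) =
    ((volume : Measure (ℝ × (Fin d → ℝ))).restrict
      (Set.Icc (0 : ℝ) 1 ×ˢ Set.Icc (0 : Fin d → ℝ) 1)).withDensity
        fun z => ENNReal.ofReal (f z.1 z.2)
  density_continuous : ContinuousOn (fun z : ℝ × (Fin d → ℝ) => f z.1 z.2)
    (Set.Icc (0 : ℝ) 1 ×ˢ Set.Icc (0 : Fin d → ℝ) 1)
  density_lower : ∃ c : ℝ, 0 < c ∧
    ∀ y ∈ Set.Icc (0 : ℝ) 1, ∀ x ∈ Set.Icc (0 : Fin d → ℝ) 1, c ≤ f y x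

theorem IsDGP.isCubeSample {Ω : Type*} [MeasurableSpace Ω] {P : Measure Ω} {d : ℕ}
    {Y : ℕ → Ω → ℝ} {X : ℕ → Ω → Fin d → ℝ} {f : ℝ → (Fin d → ℝ) → ℝ} (hD : IsDGP P Y X f) :
    IsCubeSample P Y X f :=
  { hD with }

namespace IsCubeSample

variable {Ω : Type*} [MeasurableSpace Ω] {P : Measure Ω} {d : ℕ} {Y : ℕ → Ω → ℝ}
  {X : ℕ → Ω → Fin d → ℝ} {f : ℝ → (Fin d → ℝ) → ℝ} (hD : IsCubeSample P Y X f)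
include hD

theorem continuousOn_marginalX : ContinuousOn (marginalX f) (Set.Icc 0 1) :=
  continuousOn_setIntegral isCompact_Icc isCompact_Icc hD.density_continuous

theorem continuousOn_marginalY : ContinuousOn (marginalY f) (Set.Icc 0 1) :=
  continuousOn_setIntegral (f := fun x y => f y x) isCompact_Icc isCompact_Icc
    (hD.density_continuous.comp (f := Prod.swap) continuous_swap.continuousOn
      fun _ hz => ⟨hz.2, hz.1⟩)

theorem continuousOn_density_left {x : Fin d → ℝ} (hx : x ∈ Set.Icc (0 : Fin d → ℝ) 1) :
    ContinuousOn (fun y => f y x) (Set.Icc 0 1) :=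
  hD.density_continuous.comp (f := fun y => (y, x)) (by fun_prop) fun _ hy => ⟨hy, hx⟩

theorem continuousOn_density_right {y : ℝ} (hy : y ∈ Set.Icc (0 : ℝ) 1) :
    ContinuousOn (f y) (Set.Icc 0 1) :=
  hD.density_continuous.comp (f := fun x => (y, x)) (by fun_prop) fun _ hx => ⟨hy, hx⟩

theorem marginalX_pos {x : Fin d → ℝ} (hx : x ∈ Set.Icc (0 : Fin d → ℝ) 1) :
    0 < marginalX f x := by
  obtain ⟨c, hc, hcf⟩ := hD.density_lower
  calc 0 < ∫ _ in Set.Icc (0 : ℝ) 1, c := by simpa using hc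
    _ ≤ marginalX f x := setIntegral_mono_on (integrableOn_const (by simp))
      ((hD.continuousOn_density_left hx).integrableOn_compact isCompact_Icc) measurableSet_Icc
      fun y hy => hcf y hy x hx

theorem marginalY_pos {y : ℝ} (hy : y ∈ Set.Icc (0 : ℝ) 1) : 0 < marginalY f y := by
  obtain ⟨c, hc, hcf⟩ := hD.density_lower
  calc 0 < ∫ _ in Set.Icc (0 : Fin d → ℝ) 1, c := by
        simpa [measureReal_def, Real.volume_Icc_pi] using hc
    _ ≤ marginalY f y := setIntegral_mono_on (integrableOn_const (by simp [Real.volume_Icc_pi]))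
      ((hD.continuousOn_density_right hy).integrableOn_compact isCompact_Icc) measurableSet_Icc
      fun x hx => hcf y hy x hx

theorem integral_comp_prodMk (i : ℕ) {F : ℝ × (Fin d → ℝ) → ℝ} (hF : Continuous F) :
    ∫ ω, F (Y i ω, X i ω) ∂P =
      ∫ z in Set.Icc (0 : ℝ) 1 ×ˢ Set.Icc (0 : Fin d → ℝ) 1, f z.1 z.2 * F z := by
  have hm : MeasurableSet (Set.Icc (0 : ℝ) 1 ×ˢ Set.Icc (0 : Fin d → ℝ) 1) :=
    measurableSet_Icc.prod measurableSet_Icc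
  rw [← integral_map ((hD.measurable_Y i).prodMk (hD.measurable_X i)).aemeasurable
    hF.aestronglyMeasurable, hD.law i, integral_withDensity_eq_integral_toReal_smul₀
    (hD.density_continuous.aemeasurable hm).ennreal_ofReal (by simp)]
  obtain ⟨c, hc, hcf⟩ := hD.density_lower
  refine setIntegral_congr_fun hm fun z hz => ?_
  simp only [smul_eq_mul, ENNReal.toReal_ofReal (hc.le.trans (hcf _ hz.1 _ hz.2))]

theorem integrable_density_mul {F : ℝ × (Fin d → ℝ) → ℝ} (hF : Continuous F) :
    Integrable (fun z : ℝ × (Fin d → ℝ) => f z.1 z.2 * F z)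
      ((volume.restrict (Set.Icc (0 : ℝ) 1)).prod
        (volume.restrict (Set.Icc (0 : Fin d → ℝ) 1))) := by
  rw [Measure.prod_restrict, ← Measure.volume_eq_prod]
  exact (hD.density_continuous.mul hF.continuousOn).integrableOn_compact
    (isCompact_Icc.prod isCompact_Icc)

theorem integral_comp_X (i : ℕ) {F : (Fin d → ℝ) → ℝ} (hF : Continuous F) :
    ∫ ω, F (X i ω) ∂P = ∫ x in Set.Icc (0 : Fin d → ℝ) 1, F x * marginalX f x := by
  rw [hD.integral_comp_prodMk i (F := fun z => F z.2) (by fun_prop), Measure.volume_eq_prod,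
    ← Measure.prod_restrict, integral_prod_symm _ (hD.integrable_density_mul (by fun_prop))]
  congr 1
  ext x
  exact (integral_mul_const (F x) fun u => f u x).trans (mul_comm _ _)

theorem integral_comp_Y (i : ℕ) {F : ℝ → ℝ} (hF : Continuous F) :
    ∫ ω, F (Y i ω) ∂P = ∫ y in Set.Icc (0 : ℝ) 1, F y * marginalY f y := by
  rw [hD.integral_comp_prodMk i (F := fun z => F z.1) (by fun_prop), Measure.volume_eq_prod,
    ← Measure.prod_restrict, integral_prod _ (hD.integrable_density_mul (by fun_prop))]
  congr 1
  ext y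
  exact (integral_mul_const (F y) fun u => f y u).trans (mul_comm _ _)

theorem iIndepFun_X : iIndepFun X P :=
  hD.indep.comp (fun _ => Prod.snd) fun _ => measurable_snd

theorem iIndepFun_Y : iIndepFun Y P :=
  hD.indep.comp (fun _ => Prod.fst) fun _ => measurable_fst

theorem ae_mem_cube (i : ℕ) :
    ∀ᵐ ω ∂P, Y i ω ∈ Set.Icc (0 : ℝ) 1 ∧ X i ω ∈ Set.Icc (0 : Fin d → ℝ) 1 := by
  refine ae_of_ae_map (p := fun z => z ∈ Set.Icc (0 : ℝ) 1 ×ˢ Set.Icc (0 : Fin d → ℝ) 1)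
    ((hD.measurable_Y i).prodMk (hD.measurable_X i)).aemeasurable ?_
  rw [hD.law i]
  exact (withDensity_absolutelyContinuous _ _).ae_le
    (ae_restrict_mem (measurableSet_Icc.prod measurableSet_Icc))

end IsCubeSample

/-! ### Kernel averages -/

section RescaledAverage

variable {E : Type*} [NormedAddCommGroup E] [NormedSpace ℝ E] [FiniteDimensional ℝ E]
  [MeasurableSpace E] [BorelSpace E] {x : E} {C D : Set E} {w φ : E → ℝ} {h : ℕ → ℝ}

theorem tendsto_setIntegral_comp_rescale_div (vol : Measure E) [vol.IsAddHaarMeasure]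
    (hC : IsCompact C) (hD : MeasurableSet D) (hx : x ∈ C)
    (hCD : ∀ v, ∀ᶠ h in 𝓝[>] (0 : ℝ), (x + h • v ∈ C ↔ v ∈ D)) (hw : ContinuousOn w C)
    (hφ : Continuous φ) (hφs : HasCompactSupport φ) (hpos : ∀ n, 0 < h n)
    (hzero : Tendsto h atTop (𝓝 0)) :
    Tendsto (fun n => (∫ s in C, φ ((h n)⁻¹ • (s - x)) * w s ∂vol) / h n ^ Module.finrank ℝ E)
      atTop (𝓝 (w x * ∫ v in D, φ v ∂vol)) := by
  refine ((tendsto_setIntegral_rescaled vol hC hD hx hCD hw hφ hφs).comp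
    (tendsto_nhdsWithin_iff.2 ⟨hzero, .of_forall hpos⟩)).congr fun n => ?_
  rw [setIntegral_eq_rescaled vol hC.measurableSet _ x (hpos n),
    mul_div_cancel_left₀ _ (pow_ne_zero _ (hpos n).ne')]
  simp [smul_smul, (hpos n).ne']

theorem tendstoInMeasure_rescaled_average (vol : Measure E) [vol.IsAddHaarMeasure]
    {Ω : Type*} [MeasurableSpace Ω] {P : Measure Ω} [IsProbabilityMeasure P] {Z : ℕ → Ω → E}
    (hZ : ∀ i, Measurable (Z i)) (hind : iIndepFun Z P)
    (hdens : ∀ i {F : E → ℝ}, Continuous F → ∫ ω, F (Z i ω) ∂P = ∫ s in C, F s * w s ∂vol)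
    (hC : IsCompact C) (hD : MeasurableSet D) (hx : x ∈ C)
    (hCD : ∀ v, ∀ᶠ h in 𝓝[>] (0 : ℝ), (x + h • v ∈ C ↔ v ∈ D)) (hw : ContinuousOn w C)
    (hφ : Continuous φ) (hφs : HasCompactSupport φ) (hpos : ∀ n, 0 < h n)
    (hzero : Tendsto h atTop (𝓝 0))
    (hrate : Tendsto (fun n : ℕ => (n : ℝ) * h n ^ Module.finrank ℝ E) atTop atTop) :
    TendstoInMeasure P (fun (n : ℕ) ω => 1 / ((n : ℝ) * h n ^ Module.finrank ℝ E) *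
      ∑ i ∈ Finset.range n, φ ((h n)⁻¹ • (Z i ω - x))) atTop
      (fun _ => w x * ∫ v in D, φ v ∂vol) := by
  obtain ⟨M, hM⟩ := hφs.exists_bound_of_continuous hφ
  have hcont : ∀ n, Continuous fun z => φ ((h n)⁻¹ • (z - x)) := fun n => by fun_prop
  have hmean := tendsto_setIntegral_comp_rescale_div vol hC hD hx hCD hw hφ hφs hpos hzero
  have habs := tendsto_setIntegral_comp_rescale_div vol hC hD hx hCD hw (φ := fun v => |φ v|)
    hφ.abs hφs.norm hpos hzero
  refine tendstoInMeasure_scaled_average (V := fun n i ω => φ ((h n)⁻¹ • (Z i ω - x)))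
    (fun n i => ?_) (fun n i ω => hM _) (fun n i j hij => ?_)
    (fun n i => hdens i (hcont n)) (fun n i => hdens i (hcont n).abs) hrate hmean habs
  · exact ((hcont n).measurable.comp (hZ i)).aestronglyMeasurable
  · exact (hind.indepFun hij).comp (hcont n).measurable (hcont n).measurable

end RescaledAverage

namespace IsCubeSample

variable {Ω : Type*} [MeasurableSpace Ω] {P : Measure Ω} [IsProbabilityMeasure P] {d : ℕ}
  {Y : ℕ → Ω → ℝ} {X : ℕ → Ω → Fin d → ℝ} {f : ℝ → (Fin d → ℝ) → ℝ}
  (hD : IsCubeSample P Y X f) {h : ℕ → ℝ} (hpos : ∀ n, 0 < h n) (hzero : Tendsto h atTop (𝓝 0))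
include hD hpos hzero

theorem tendsto_average_X (hrate : Tendsto (fun n : ℕ => (n : ℝ) * h n ^ d) atTop atTop)
    {x : Fin d → ℝ} (hx : x ∈ Set.Icc (0 : Fin d → ℝ) 1) {φ : (Fin d → ℝ) → ℝ}
    (hφ : Continuous φ) (hφs : HasCompactSupport φ) :
    Tendsto (fun z : ℕ × Ω => 1 / ((z.1 : ℝ) * h z.1 ^ d) *
      ∑ i ∈ Finset.range z.1, φ (scaled (h z.1) x (X i z.2))) (inProbability P atTop)
      (𝓝 (marginalX f x * ∫ v in tangentConeCube x, φ v)) := by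
  have hscaled : ∀ n x', scaled (h n) x x' = (h n)⁻¹ • (x' - x) := fun n x' => by
    ext j; simp [scaled, div_eq_inv_mul]
  have key := tendstoInMeasure_rescaled_average volume hD.measurable_X hD.iIndepFun_X
    hD.integral_comp_X isCompact_Icc (measurableSet_tangentConeCube x) hx
    (eventually_mem_cube_iff hx) hD.continuousOn_marginalX hφ hφs hpos hzero
    (by rwa [Module.finrank_fin_fun])
  rw [Module.finrank_fin_fun] at key
  simpa only [hscaled] using tendsto_inProbability_iff.2 key

theorem tendsto_average_Y (hrate : Tendsto (fun n : ℕ => (n : ℝ) * h n) atTop atTop) {y : ℝ}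
    (hy : y ∈ Set.Icc (0 : ℝ) 1) {φ : ℝ → ℝ} (hφ : Continuous φ) (hφs : HasCompactSupport φ) :
    Tendsto (fun z : ℕ × Ω => 1 / ((z.1 : ℝ) * h z.1) *
      ∑ i ∈ Finset.range z.1, φ ((Y i z.2 - y) / h z.1)) (inProbability P atTop)
      (𝓝 (marginalY f y * ∫ v in tangentConeIcc y, φ v)) := by
  have key := tendstoInMeasure_rescaled_average volume hD.measurable_Y hD.iIndepFun_Y
    hD.integral_comp_Y isCompact_Icc (measurableSet_tangentConeIcc y) hy
    (eventually_mem_Icc_iff hy) hD.continuousOn_marginalY hφ hφs hpos hzero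
    (by simpa only [Module.finrank_self, pow_one] using hrate)
  simpa only [Module.finrank_self, pow_one, smul_eq_mul, ← div_eq_inv_mul] using
    tendsto_inProbability_iff.2 key

end IsCubeSample

theorem tendsto_mul_pow_of_tendsto_div_log {d : ℕ} {h : ℕ → ℝ} (hpos : ∀ n, 0 < h n)
    (hrate : Tendsto (fun n : ℕ => (n : ℝ) * h n ^ d / Real.log n) atTop atTop) :
    Tendsto (fun n : ℕ => (n : ℝ) * h n ^ d) atTop atTop := by
  refine tendsto_atTop_mono' _ ?_ hrate
  have hlog : Tendsto (fun n : ℕ => Real.log n) atTop atTop :=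
    Real.tendsto_log_atTop.comp tendsto_natCast_atTop_atTop
  filter_upwards [hlog.eventually_ge_atTop 1] with n hn
  have := hpos n
  exact div_le_self (by positivity) hn

theorem tendsto_mul_of_tendsto_mul_pow {d : ℕ} (hd : 1 ≤ d) {h : ℕ → ℝ} (hpos : ∀ n, 0 < h n)
    (hzero : Tendsto h atTop (𝓝 0))
    (hrate : Tendsto (fun n : ℕ => (n : ℝ) * h n ^ d) atTop atTop) :
    Tendsto (fun n : ℕ => (n : ℝ) * h n) atTop atTop := by
  refine tendsto_atTop_mono' _ ?_ hrate
  filter_upwards [hzero.eventually_le_const one_pos] with n hn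
  exact mul_le_mul_of_nonneg_left (pow_le_of_le_one (hpos n).le hn (by omega)) (Nat.cast_nonneg n)

/-! ### The leading bias -/

variable {ι : Type*} {l : Filter ι}

section Coordinate

variable {J κ : Type*} [Fintype κ] [DecidableEq κ] [DecidableEq J] {e : κ → J} {deg : J → ℕ}
  {r : ℕ} {j₀ : J} {h : ι → ℝ} {c c' : ι → J → κ → ℝ} {c₀ : J → κ → ℝ}

/-- The contribution of exponent `k` to the leading bias of the extracted coefficient `j₀`: only
the exponents of degree `r + 1`, just beyond the basis, contribute. -/
noncomputable def leadingCorrection (deg : J → ℕ) (r : ℕ) (e : κ → J) (c : J → κ → ℝ) (j₀ : J)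
    (h : ℝ) (k : J) : ℝ :=
  if deg k = r + 1 then h ^ (r + 1 - deg j₀) * extractionWeight e c j₀ k else 0

theorem isBigO_leadingCorrection (hc : TendstoMultiple c l c₀)
    (hdet : (momentMatrix e c₀).det ≠ 0) (k : J) :
    (fun i => leadingCorrection deg r e (c i) j₀ (h i) k) =O[l]
      fun i => h i ^ (r + 1 - deg j₀) := by
  by_cases hk : deg k = r + 1
  · simpa [leadingCorrection, hk] using
      (isBigO_refl _ l).mul ((hc.extractionWeight hdet j₀ k).isBigO_one ℝ)
  · simpa [leadingCorrection, hk] using isBigO_zero _ l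

theorem isLittleO_scaled_extractionWeight_sub (hj₀ : deg j₀ ≤ r)
    (he : ∀ k, deg k ≤ r → k ∈ Set.range e) (hh : Tendsto h l (𝓝[>] 0))
    (hc : TendstoMultiple c l c₀) (hc' : TendstoMultiple c' l c₀)
    (hdet : (momentMatrix e c₀).det ≠ 0) (k : J) :
    (fun i => h i ^ deg k / h i ^ deg j₀ * extractionWeight e (c i) j₀ k -
        ((if k = j₀ then 1 else 0) + leadingCorrection deg r e (c' i) j₀ (h i) k)) =o[l]
      fun i => h i ^ (r + 1 - deg j₀) := by
  obtain ⟨hzero, hpos⟩ := tendsto_nhdsWithin_iff.1 hh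
  have hw := hc.extractionWeight hdet j₀ k
  have hne : r < deg k → k ≠ j₀ := by rintro hk rfl; omega
  have hpow : r < deg k → ∀ᶠ i in l, h i ^ deg k / h i ^ deg j₀ = h i ^ (deg k - deg j₀) :=
    fun hk => hpos.mono fun i hi => (pow_sub₀ _ (ne_of_gt hi) (by omega)).symm
  rcases lt_trichotomy (deg k) (r + 1) with hk | hk | hk
  · obtain ⟨a, rfl⟩ := he k (by omega)
    refine (isLittleO_zero _ l).congr' ?_ .rfl
    filter_upwards [hpos, hc.eventually_det_ne_zero hdet] with i hi hi'
    rw [extractionWeight_apply hi', leadingCorrection, if_neg hk.ne]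
    split_ifs with heq
    · rw [heq, div_self (pow_ne_zero _ (ne_of_gt hi)), mul_one, add_zero, sub_self]
    · simp
  · have hsub : Tendsto (fun i => extractionWeight e (c i) j₀ k - extractionWeight e (c' i) j₀ k) l
        (𝓝 0) := by
      simpa using hw.sub (hc'.extractionWeight hdet j₀ k)
    refine ((isBigO_refl (fun i => h i ^ (r + 1 - deg j₀)) l).mul_isLittleO
      ((isLittleO_one_iff ℝ).2 hsub)).congr' ?_ (.of_eq (funext fun i => mul_one _))
    filter_upwards [hpow (by omega)] with i hi
    rw [hi, leadingCorrection, if_pos hk, if_neg (hne (by omega)), hk]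
    ring
  · have hdeg : r + 1 - deg j₀ < deg k - deg j₀ := by omega
    refine (((isLittleO_pow_pow (𝕜 := ℝ) hdeg).comp_tendsto hzero).mul_isBigO
      (hw.isBigO_one ℝ)).congr' ?_ (.of_eq (funext fun i => mul_one _))
    filter_upwards [hpow (by omega)] with i hi
    simp [hi, leadingCorrection, if_neg hk.ne', if_neg (hne (by omega))]

end Coordinate

theorem isLittleO_mul_sub_leading {f g u w F G R : ι → ℝ} {δ ε : ℝ}
    (hf : (fun i => f i - (δ + u i)) =o[l] F) (hg : (fun i => g i - (ε + w i)) =o[l] G)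
    (hu : u =O[l] F) (hw : w =O[l] G) (hF : Tendsto F l (𝓝 0)) (hG : Tendsto G l (𝓝 0))
    (hFR : F =O[l] R) (hGR : G =O[l] R) :
    (fun i => f i * g i - (δ * ε + δ * w i + u i * ε)) =o[l] R := by
  have hF₁ : F =o[l] fun _ => (1 : ℝ) := (isLittleO_one_iff ℝ).2 hF
  have hG₁ : G =o[l] fun _ => (1 : ℝ) := (isLittleO_one_iff ℝ).2 hG
  have hδu : (fun i => δ + u i) =O[l] fun _ => (1 : ℝ) :=
    (isBigO_const_const δ one_ne_zero l).add (hu.trans_isLittleO hF₁).isBigO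
  have hεw : (fun i => ε + w i) =O[l] fun _ => (1 : ℝ) :=
    (isBigO_const_const ε one_ne_zero l).add (hw.trans_isLittleO hG₁).isBigO
  have hg₁ : g =O[l] fun _ => (1 : ℝ) := by
    simpa using (hg.trans hG₁).isBigO.add hεw
  have h₁ : (fun i => (f i - (δ + u i)) * g i) =o[l] R := by
    simpa using (hf.trans_isBigO hFR).mul_isBigO hg₁
  have h₂ : (fun i => (δ + u i) * (g i - (ε + w i))) =o[l] R := by
    simpa using hδu.mul_isLittleO (hg.trans_isBigO hGR)
  have h₃ : (fun i => u i * w i) =o[l] R := by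
    simpa using (hu.trans_isLittleO hF₁).mul_isBigO (hw.trans hGR)
  exact ((h₁.add h₂).add h₃).congr_left fun i => by ring

section Matrices

variable {κ κ' : Type*} [Fintype κ] [Fintype κ']

theorem isLittleO_dotProduct_mul_mul_mulVec {A : ι → Matrix κ κ ℝ} {E : ι → Matrix κ κ' ℝ}
    {B : ι → Matrix κ' κ' ℝ} {F : ι → ℝ} (hA : ∀ a b, (fun i => A i a b) =O[l] fun _ => (1 : ℝ))
    (hE : ∀ a b, (fun i => E i a b) =o[l] F) (hB : ∀ a b, (fun i => B i a b) =O[l] fun _ => (1 : ℝ))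
    (u : κ → ℝ) (v : κ' → ℝ) :
    (fun i => u ⬝ᵥ (A i * E i * B i) *ᵥ v) =o[l] F := by
  simp only [dotProduct, mulVec, mul_apply]
  have hAE : ∀ a b, (fun i => ∑ k, A i a k * E i k b) =o[l] F := fun a b =>
    .fun_sum fun k _ => by simpa using (hA a k).mul_isLittleO (hE k b)
  have hAEB : ∀ a b, (fun i => ∑ k, (∑ k', A i a k' * E i k' k) * B i k b) =o[l] F := fun a b =>
    .fun_sum fun k _ => by simpa using (hAE a k).mul_isBigO (hB k b)
  exact .fun_sum fun a _ => (IsLittleO.fun_sum fun b _ =>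
    ((hAEB a b).const_mul_left (v b)).congr_left fun i => mul_comm _ _).const_mul_left (u a)

theorem dotProduct_mul_vecMulVec_mul_mulVec (A : Matrix κ κ ℝ) (B : Matrix κ' κ' ℝ) (u a : κ → ℝ)
    (v b : κ' → ℝ) :
    u ⬝ᵥ (A * vecMulVec a b * B) *ᵥ v = (u ⬝ᵥ A *ᵥ a) * (b ⬝ᵥ B *ᵥ v) := by
  rw [mul_vecMulVec, vecMulVec_mul, vecMulVec_mulVec, ← dotProduct_mulVec]
  simp [dotProduct_smul, mul_comm]

theorem dotProduct_mul_sum_vecMulVec_mul_mulVec {σ : Type*} (s : Finset σ) (θ : σ → ℝ)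
    (a : σ → κ → ℝ) (b : σ → κ' → ℝ) (A : Matrix κ κ ℝ) (B : Matrix κ' κ' ℝ) (u : κ → ℝ)
    (v : κ' → ℝ) :
    u ⬝ᵥ (A * (∑ t ∈ s, θ t • vecMulVec (a t) (b t)) * B) *ᵥ v =
      ∑ t ∈ s, θ t * ((u ⬝ᵥ A *ᵥ a t) * (b t ⬝ᵥ B *ᵥ v)) := by
  simp only [Matrix.mul_sum, Matrix.sum_mul, Matrix.mul_smul, Matrix.smul_mul, sum_mulVec,
    dotProduct_sum, smul_mulVec, dotProduct_smul, smul_eq_mul, dotProduct_mul_vecMulVec_mul_mulVec]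

theorem dotProduct_mulVec_comm_of_isSymm {A : Matrix κ κ ℝ} (hA : A.IsSymm) (u v : κ → ℝ) :
    u ⬝ᵥ A *ᵥ v = v ⬝ᵥ A *ᵥ u := by
  rw [dotProduct_mulVec, ← mulVec_transpose, hA.eq, dotProduct_comm]

end Matrices

section DegPairs

variable {d M : ℕ}

/-- Pairs `(k, m)` of exponents of total degree at most `M`, indexing the terms of the Taylor
expansion of order `M`. -/
def degPairs (d M : ℕ) : Finset (ℕ × (Fin d → ℕ)) :=
  {s ∈ Finset.range (M + 1) ×ˢ multiIdx d M | s.1 + ∑ j, s.2 j ≤ M}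

theorem mem_degPairs {s : ℕ × (Fin d → ℕ)} : s ∈ degPairs d M ↔ s.1 + ∑ j, s.2 j ≤ M := by
  simp only [degPairs, Finset.mem_filter, Finset.mem_product, Finset.mem_range, mem_multiIdx]
  omega

/-- The Taylor sum of order `M` in coordinates rescaled by `h`, with derivatives `θ k m` and with
`γ k`, `η m` in place of the monomials `u^k/k!`, `v^m/m!`: taking the monomials gives a polynomial,
and taking their kernel moments gives the smoothed polynomial. -/
def taylorSum (M : ℕ) (θ : ℕ → (Fin d → ℕ) → ℝ) (h : ℝ) (γ : ℕ → ℝ) (η : (Fin d → ℕ) → ℝ) : ℝ :=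
  ∑ s ∈ degPairs d M, h ^ (s.1 + ∑ j, s.2 j) * θ s.1 s.2 * (γ s.1 * η s.2)

theorem sum_degPairs_fst_eq {r μ : ℕ} (hM : r + μ ≤ M) (φ : (Fin d → ℕ) → ℝ) :
    (∑ s ∈ degPairs d M, if s.1 = μ ∧ ∑ j, s.2 j = r then φ s.2 else 0) =
      ∑ m ∈ multiIdx d r with ∑ j, m j = r, φ m := by
  rw [← Finset.sum_filter]
  refine (Finset.sum_nbij' (fun m => (μ, m)) Prod.snd ?_ ?_ ?_ ?_ ?_).symm
  all_goals simp only [Finset.mem_filter, mem_degPairs, mem_multiIdx, Prod.forall]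
  · exact fun m hm => ⟨by omega, trivial, hm.2⟩
  · exact fun k m hm => ⟨hm.2.2.le, hm.2.2⟩
  · exact fun _ _ => trivial
  · exact fun k m hm => by rw [hm.2.1]
  · exact fun _ _ => trivial

theorem sum_degPairs_leading {p q μ : ℕ} {ν : Fin d → ℕ} (hM₀ : μ + ∑ j, ν j ≤ M)
    (hM₁ : q + 1 + μ ≤ M) (hM₂ : p + 1 + ∑ j, ν j ≤ M) (θ : ℕ → (Fin d → ℕ) → ℝ) (α : ℕ → ℝ)
    (β : (Fin d → ℕ) → ℝ) :
    ∑ s ∈ degPairs d M, θ s.1 s.2 * ((if s.1 = μ then 1 else 0) * (if s.2 = ν then 1 else 0) +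
        (if s.1 = μ then 1 else 0) * (if ∑ j, s.2 j = q + 1 then β s.2 else 0) +
        (if s.1 = p + 1 then α s.1 else 0) * (if s.2 = ν then 1 else 0)) =
      θ μ ν + (∑ m ∈ multiIdx d (q + 1) with ∑ j, m j = q + 1, θ μ m * β m) +
        θ (p + 1) ν * α (p + 1) := by
  calc
    _ = ∑ s ∈ degPairs d M, ((if s = (μ, ν) then θ μ ν else 0) +
        (if s.1 = μ ∧ ∑ j, s.2 j = q + 1 then θ μ s.2 * β s.2 else 0) +
        (if s = (p + 1, ν) then θ (p + 1) ν * α (p + 1) else 0)) := by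
      refine Finset.sum_congr rfl fun ⟨k, m⟩ _ => ?_
      by_cases hk : k = μ <;> by_cases hm : m = ν <;> by_cases hk' : k = p + 1 <;>
        by_cases hm' : ∑ j, m j = q + 1 <;> simp_all <;> ring
    _ = _ := by
      rw [Finset.sum_add_distrib, Finset.sum_add_distrib, Finset.sum_ite_eq', Finset.sum_ite_eq',
        sum_degPairs_fst_eq hM₁ fun m => θ μ m * β m, if_pos (mem_degPairs.2 hM₀),
        if_pos (mem_degPairs.2 hM₂)]

end DegPairs

section LeadingBias

/-- The leading bias for an arbitrary array `θ` of derivatives and arbitrary moments `cy`, `cx`;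
`leadingBias` is the case of the derivatives of `F(y|x)` and of the population moments. -/
noncomputable def leadingBiasOf {d p q : ℕ} (μ : ℕ) (ν : Fin d → ℕ) (θ : ℕ → (Fin d → ℕ) → ℝ)
    (cy : ℕ → Fin (p + 1) → ℝ) (cx : (Fin d → ℕ) → multiIdx d q → ℝ) (h : ℝ) : ℝ :=
  h ^ (q + 1 - ∑ j, ν j) * (∑ m ∈ multiIdx d (q + 1) with ∑ j, m j = q + 1,
      θ μ m * extractionWeight Subtype.val cx ν m) +
    h ^ (p + 1 - μ) * (θ (p + 1) ν * extractionWeight Fin.val cy μ (p + 1))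

variable {d p q μ M : ℕ} {ν : Fin d → ℕ} {h : ι → ℝ} {cy cy' : ι → ℕ → Fin (p + 1) → ℝ}
  {cy₀ : ℕ → Fin (p + 1) → ℝ} {cx cx' : ι → (Fin d → ℕ) → multiIdx d q → ℝ}
  {cx₀ : (Fin d → ℕ) → multiIdx d q → ℝ} {θ : ℕ → (Fin d → ℕ) → ℝ}

theorem isBigO_biasRate_left (h : ι → ℝ) (hpos : ∀ᶠ i in l, 0 < h i) :
    (fun i => h i ^ (q + 1 - ∑ j, ν j)) =O[l] fun i => biasRate p q μ ν (h i) := by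
  refine .of_norm_eventuallyLE ?_
  filter_upwards [hpos] with i hi
  rw [Real.norm_of_nonneg (by positivity), biasRate]
  exact le_add_of_nonneg_right (by positivity)

theorem isBigO_biasRate_right (h : ι → ℝ) (hpos : ∀ᶠ i in l, 0 < h i) :
    (fun i => h i ^ (p + 1 - μ)) =O[l] fun i => biasRate p q μ ν (h i) := by
  refine .of_norm_eventuallyLE ?_
  filter_upwards [hpos] with i hi
  rw [Real.norm_of_nonneg (by positivity), biasRate]
  exact le_add_of_nonneg_left (by positivity)

theorem isBigO_pow_div_pow_biasRate (hM : q + 1 + μ ≤ M) (hν : ∑ j, ν j ≤ q)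
    (hh : Tendsto h l (𝓝[>] 0)) :
    (fun i => h i ^ M / h i ^ (μ + ∑ j, ν j)) =O[l] fun i => biasRate p q μ ν (h i) := by
  obtain ⟨hzero, hpos⟩ := tendsto_nhdsWithin_iff.1 hh
  refine IsBigO.trans (.of_norm_eventuallyLE ?_) (isBigO_biasRate_left h hpos)
  filter_upwards [hpos, hzero.eventually_le_const one_pos] with i hi hi1
  have hi : 0 < h i := hi
  rw [Real.norm_of_nonneg (by positivity), div_eq_mul_inv, ← pow_sub₀ _ hi.ne' (by omega)]
  exact pow_le_pow_of_le_one hi.le hi1 (by omega)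

theorem isLittleO_sum_degPairs_sub_leadingBias (hμ : μ ≤ p) (hν : ∑ j, ν j ≤ q)
    (hM₁ : q + 1 + μ ≤ M) (hM₂ : p + 1 + ∑ j, ν j ≤ M) (hh : Tendsto h l (𝓝[>] 0))
    (hcy : TendstoMultiple cy l cy₀) (hcy' : TendstoMultiple cy' l cy₀)
    (hcx : TendstoMultiple cx l cx₀) (hcx' : TendstoMultiple cx' l cx₀)
    (hdety : (momentMatrix Fin.val cy₀).det ≠ 0)
    (hdetx : (momentMatrix Subtype.val cx₀).det ≠ 0) :
    (fun i => ∑ s ∈ degPairs d M, θ s.1 s.2 *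
        ((h i ^ s.1 / h i ^ μ * extractionWeight Fin.val (cy i) μ s.1) *
          (h i ^ (∑ j, s.2 j) / h i ^ (∑ j, ν j) * extractionWeight Subtype.val (cx i) ν s.2)) -
      (θ μ ν + leadingBiasOf μ ν θ (cy' i) (cx' i) (h i))) =o[l]
      fun i => biasRate p q μ ν (h i) := by
  obtain ⟨hzero, hpos⟩ := tendsto_nhdsWithin_iff.1 hh
  have hpow_zero {n : ℕ} (hn : n ≠ 0) : Tendsto (fun i => h i ^ n) l (𝓝 0) := by
    simpa [hn] using hzero.pow n
  have hterm (s : ℕ × (Fin d → ℕ)) := isLittleO_mul_sub_leading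
    (isLittleO_scaled_extractionWeight_sub (deg := id) hμ
      (fun k hk => ⟨⟨k, Nat.lt_succ_of_le hk⟩, rfl⟩) hh hcy hcy' hdety s.1)
    (isLittleO_scaled_extractionWeight_sub (deg := fun m => ∑ j, m j) hν
      (fun m hm => ⟨⟨m, mem_multiIdx.2 hm⟩, rfl⟩) hh hcx hcx' hdetx s.2)
    (isBigO_leadingCorrection hcy' hdety s.1) (isBigO_leadingCorrection hcx' hdetx s.2)
    (hpow_zero (Nat.sub_ne_zero_of_lt (Nat.lt_succ_of_le hμ)))
    (hpow_zero (Nat.sub_ne_zero_of_lt (Nat.lt_succ_of_le hν)))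
    (isBigO_biasRate_right (q := q) (ν := ν) h hpos) (isBigO_biasRate_left (p := p) (μ := μ) h hpos)
  refine (IsLittleO.fun_sum (s := degPairs d M) fun s _ =>
    (hterm s).const_mul_left (θ s.1 s.2)).congr_left fun i => ?_
  simp only [mul_sub, Finset.sum_sub_distrib, leadingCorrection, leadingBiasOf, id]
  rw [sum_degPairs_leading (by omega) hM₁ hM₂ θ
    (fun k => h i ^ (p + 1 - μ) * extractionWeight Fin.val (cy' i) μ k)
    fun m => h i ^ (q + 1 - ∑ j, ν j) * extractionWeight Subtype.val (cx' i) ν m, Finset.mul_sum]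
  simp only [mul_left_comm (θ _ _), add_assoc]

theorem isLittleO_sandwich_sub_leadingBias (hμ : μ ≤ p) (hν : ∑ j, ν j ≤ q)
    (hM₁ : q + 1 + μ ≤ M) (hM₂ : p + 1 + ∑ j, ν j ≤ M) (hh : Tendsto h l (𝓝[>] 0))
    (hcy : TendstoMultiple cy l cy₀) (hcy' : TendstoMultiple cy' l cy₀)
    (hcx : TendstoMultiple cx l cx₀) (hcx' : TendstoMultiple cx' l cx₀)
    (hdety : (momentMatrix Fin.val cy₀).det ≠ 0)
    (hdetx : (momentMatrix Subtype.val cx₀).det ≠ 0)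
    (hsymm : ∀ i, (momentMatrix Fin.val (cy i)).IsSymm)
    {R : ι → Matrix (Fin (p + 1)) (multiIdx d q) ℝ}
    (hR : ∀ a b, (fun i => R i a b - taylorSum M θ (h i) (fun k => cy i k a) (fun m => cx i m b) /
      h i ^ (μ + ∑ j, ν j)) =o[l] fun i => h i ^ M / h i ^ (μ + ∑ j, ν j)) :
    (fun i => eY p μ ⬝ᵥ ((momentMatrix Fin.val (cy i))⁻¹ * R i *
        (momentMatrix Subtype.val (cx i))⁻¹) *ᵥ eX q ν -
      (θ μ ν + leadingBiasOf μ ν θ (cy' i) (cx' i) (h i))) =o[l]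
      fun i => biasRate p q μ ν (h i) := by
  set T : ι → Matrix (Fin (p + 1)) (multiIdx d q) ℝ := fun i => ∑ s ∈ degPairs d M,
    (h i ^ (s.1 + ∑ j, s.2 j) / h i ^ (μ + ∑ j, ν j) * θ s.1 s.2) •
      vecMulVec (cy i s.1) (cx i s.2) with hT
  have hE : ∀ a b, (fun i => (R i - T i) a b) =o[l] fun i => biasRate p q μ ν (h i) := by
    intro a b
    refine ((hR a b).trans_isBigO (isBigO_pow_div_pow_biasRate hM₁ hν hh)).congr_left fun i => ?_
    simp only [hT, taylorSum, Matrix.sub_apply, Matrix.sum_apply, Matrix.smul_apply,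
      vecMulVec_apply, smul_eq_mul, Finset.sum_div]
    exact congrArg _ (Finset.sum_congr rfl fun s _ => by ring)
  have hremainder := isLittleO_dotProduct_mul_mul_mulVec
    (hcy.isBigO_inv_momentMatrix hdety) hE (hcx.isBigO_inv_momentMatrix hdetx) (eY p μ) (eX q ν)
  have hmain i : eY p μ ⬝ᵥ ((momentMatrix Fin.val (cy i))⁻¹ * T i *
      (momentMatrix Subtype.val (cx i))⁻¹) *ᵥ eX q ν = ∑ s ∈ degPairs d M, θ s.1 s.2 *
        ((h i ^ s.1 / h i ^ μ * extractionWeight Fin.val (cy i) μ s.1) *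
          (h i ^ (∑ j, s.2 j) / h i ^ (∑ j, ν j) * extractionWeight Subtype.val (cx i) ν s.2)) := by
    rw [hT, dotProduct_mul_sum_vecMulVec_mul_mulVec]
    refine Finset.sum_congr rfl fun s _ => ?_
    rw [dotProduct_mulVec_comm_of_isSymm (hsymm i).inv, pow_add, pow_add, mul_div_mul_comm]
    rw [show eY p μ = fun a : Fin (p + 1) => if a.1 = μ then 1 else 0 from rfl,
      show eX q ν = fun b => if b.1 = ν then 1 else 0 from rfl]
    simp only [extractionWeight]
    ring
  refine (hremainder.add (isLittleO_sum_degPairs_sub_leadingBias (θ := θ) hμ hν hM₁ hM₂ hh hcy hcy'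
    hcx hcx' hdety hdetx)).congr_left fun i => ?_
  rw [← hmain i, Matrix.mul_sub, Matrix.sub_mul, sub_mulVec, dotProduct_sub]
  ring

end LeadingBias

/-! ### Limits of the moments -/

section PopulationMoments

variable {ι : Type*} {l : Filter ι} {h : ι → ℝ} {K G : ℝ → ℝ} {y : ℝ}

theorem tendsto_setIntegral_Icc_rescaled (hy : y ∈ Set.Icc (0 : ℝ) 1)
    (hh : Tendsto h l (𝓝[>] 0)) {w φ : ℝ → ℝ} (hw : ContinuousOn w (Set.Icc 0 1))
    (hφ : Continuous φ) (hφs : HasCompactSupport φ) :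
    Tendsto (fun i => ∫ u in {u : ℝ | y + h i * u ∈ Set.Icc (0 : ℝ) 1}, φ u * w (y + h i * u)) l
      (𝓝 (w y * ∫ u in tangentConeIcc y, φ u)) :=
  (tendsto_setIntegral_rescaled volume isCompact_Icc (measurableSet_tangentConeIcc y) hy
    (eventually_mem_Icc_iff hy) hw hφ hφs).comp hh

theorem isSymm_momentMatrix_cY (p : ℕ) (h : ℝ) :
    (momentMatrix Fin.val fun k => cY K G p k h y).IsSymm := by
  ext a b
  simp only [momentMatrix, Matrix.transpose_apply, Matrix.of_apply, cY, PVec, pVec]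
  congr 1
  ext u
  ring

variable (hK : IsContinuousKernel K) (hh : Tendsto h l (𝓝[>] 0))
include hK hh

theorem IsContinuousKernel.tendstoMultiple_cY (hy : y ∈ Set.Icc (0 : ℝ) 1)
    (hg : ContinuousOn (weightDensity G) (Set.Icc 0 1)) (hgy : weightDensity G y ≠ 0) (p : ℕ) :
    TendstoMultiple (fun i k => cY K G p k (h i) y) l (coneMomentIcc K p y) :=
  ⟨weightDensity G y, hgy, tendsto_pi_nhds.2 fun k => tendsto_pi_nhds.2 fun a =>
    tendsto_setIntegral_Icc_rescaled hy hh hg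
      (((continuous_pow k).div_const _).mul (hK.continuous_PVec p a))
      (hK.hasCompactSupport_PVec p a).mul_left⟩

theorem IsContinuousKernel.tendstoMultiple_cX {d : ℕ} {f : ℝ → (Fin d → ℝ) → ℝ}
    {x : Fin d → ℝ} (hx : x ∈ Set.Icc (0 : Fin d → ℝ) 1)
    (hf : ContinuousOn (marginalX f) (Set.Icc 0 1)) (hfx : marginalX f x ≠ 0) (q : ℕ) :
    TendstoMultiple (fun i m => cX K f q m (h i) x) l (coneMomentCube K q x) :=
  ⟨marginalX f x, hfx, tendsto_pi_nhds.2 fun m => tendsto_pi_nhds.2 fun b =>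
    (tendsto_setIntegral_rescaled volume isCompact_Icc (measurableSet_tangentConeCube x) hx
      (eventually_mem_cube_iff hx) hf ((continuous_mono m).mul (hK.continuous_QVec q b))
      (hK.hasCompactSupport_QVec q b).mul_left).comp hh⟩

end PopulationMoments

/-- The sample analogue of `c_{y,k}`, with the empirical measure in place of `g`; the rows of
`Ŝ_y` are `ĉ_{y,0}, …, ĉ_{y,p}`. -/
noncomputable def cYhat (K : ℝ → ℝ) (p n : ℕ) (ys : ℕ → ℝ) (k : ℕ) (h y : ℝ) : Fin (p + 1) → ℝ :=
  fun a => 1 / ((n : ℝ) * h) * ∑ j ∈ Finset.range n,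
    ((ys j - y) / h) ^ k / (k.factorial : ℝ) * PVec K p ((ys j - y) / h) a

/-- The sample analogue of `c_{x,m}`, with the empirical measure in place of `f_x`; the rows of
`Ŝ_x` are the `ĉ_{x,m}` with `|m| ≤ q`. -/
noncomputable def cXhat {d : ℕ} (K : ℝ → ℝ) (q n : ℕ) (xs : ℕ → Fin d → ℝ) (m : Fin d → ℕ) (h : ℝ)
    (x : Fin d → ℝ) : multiIdx d q → ℝ :=
  fun b => 1 / ((n : ℝ) * h ^ d) * ∑ i ∈ Finset.range n,
    mono m (scaled h x (xs i)) * QVec K q (scaled h x (xs i)) b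

theorem isSymm_momentMatrix_cYhat (K : ℝ → ℝ) (p n : ℕ) (ys : ℕ → ℝ) (h y : ℝ) :
    (momentMatrix Fin.val fun k => cYhat K p n ys k h y).IsSymm := by
  ext a b
  simp only [momentMatrix, Matrix.transpose_apply, Matrix.of_apply, cYhat, PVec, pVec]
  exact congrArg _ (Finset.sum_congr rfl fun i _ => by ring)

namespace IsCubeSample

variable {Ω : Type*} [MeasurableSpace Ω] {P : Measure Ω} [IsProbabilityMeasure P] {d : ℕ}
  {Y : ℕ → Ω → ℝ} {X : ℕ → Ω → Fin d → ℝ} {f : ℝ → (Fin d → ℝ) → ℝ}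
  (hD : IsCubeSample P Y X f) {h : ℕ → ℝ} (hpos : ∀ n, 0 < h n) (hzero : Tendsto h atTop (𝓝 0))
  {K : ℝ → ℝ} (hK : IsContinuousKernel K)
include hD hpos hzero hK

theorem tendstoMultiple_cYhat (hrate : Tendsto (fun n : ℕ => (n : ℝ) * h n) atTop atTop) {y : ℝ}
    (hy : y ∈ Set.Icc (0 : ℝ) 1) (p : ℕ) :
    TendstoMultiple (fun (z : ℕ × Ω) k => cYhat K p z.1 (fun i => Y i z.2) k (h z.1) y)
      (inProbability P atTop) (coneMomentIcc K p y) := by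
  refine ⟨marginalY f y, (hD.marginalY_pos hy).ne',
    tendsto_pi_nhds.2 fun k => tendsto_pi_nhds.2 fun a => ?_⟩
  simp only [cYhat, coneMomentIcc, Pi.smul_apply, smul_eq_mul]
  exact hD.tendsto_average_Y hpos hzero hrate hy
    (φ := fun u => u ^ k / (k.factorial : ℝ) * PVec K p u a)
    (((continuous_pow k).div_const _).mul (hK.continuous_PVec p a))
    (hK.hasCompactSupport_PVec p a).mul_left

theorem tendstoMultiple_cXhat (hrate : Tendsto (fun n : ℕ => (n : ℝ) * h n ^ d) atTop atTop)
    {x : Fin d → ℝ} (hx : x ∈ Set.Icc (0 : Fin d → ℝ) 1) (q : ℕ) :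
    TendstoMultiple (fun (z : ℕ × Ω) m => cXhat K q z.1 (fun i => X i z.2) m (h z.1) x)
      (inProbability P atTop) (coneMomentCube K q x) := by
  refine ⟨marginalX f x, (hD.marginalX_pos hx).ne',
    tendsto_pi_nhds.2 fun m => tendsto_pi_nhds.2 fun b => ?_⟩
  simp only [cXhat, coneMomentCube, Pi.smul_apply, smul_eq_mul]
  exact hD.tendsto_average_X hpos hzero hrate hx (φ := fun v => mono m v * QVec K q v b)
    ((continuous_mono m).mul (hK.continuous_QVec q b))
    (hK.hasCompactSupport_QVec q b).mul_left

end IsCubeSample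

/-! ### Taylor expansion of the conditional distribution function -/

section UniformTaylor

variable {d : ℕ}

theorem sum_multiIdx_succ (M : ℕ) (T : (Fin (d + 1) → ℕ) → ℝ) :
    ∑ m ∈ multiIdx (d + 1) M, T m = ∑ t ∈ degPairs d M, T (Fin.cons t.1 t.2) := by
  refine Finset.sum_bij' (fun m _ => (m 0, Fin.tail m)) (fun t _ => Fin.cons t.1 t.2)
    (fun m hm => ?_) (fun t ht => ?_) (fun m _ => Fin.cons_self_tail m) (fun t _ => by simp)
    fun m _ => by rw [Fin.cons_self_tail]
  · rw [mem_multiIdx, Fin.sum_univ_succ] at hm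
    exact mem_degPairs.2 hm
  · rw [mem_degPairs] at ht
    simpa [mem_multiIdx, Fin.sum_univ_succ] using ht

theorem mono_cons (k : ℕ) (m : Fin d → ℕ) (u : ℝ) (v : Fin d → ℝ) :
    mono (Fin.cons k m : Fin (d + 1) → ℕ) (Fin.cons u v : Fin (d + 1) → ℝ) =
      u ^ k / (k.factorial : ℝ) * mono m v := by
  simp only [mono, Fin.prod_univ_succ, Fin.cons_zero, Fin.cons_succ]

theorem mono_smul (m : Fin d → ℕ) (h : ℝ) (v : Fin d → ℝ) :
    mono m (h • v) = h ^ (∑ j, m j) * mono m v := by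
  simp only [mono, Pi.smul_apply, smul_eq_mul, mul_pow, ← Finset.prod_pow_eq_pow_sum,
    ← Finset.prod_mul_distrib, mul_div_assoc]

theorem cons_mem_cube_iff {s : ℝ} {w : Fin d → ℝ} :
    (Fin.cons s w : Fin (d + 1) → ℝ) ∈ Set.Icc (0 : Fin (d + 1) → ℝ) 1 ↔
      s ∈ Set.Icc (0 : ℝ) 1 ∧ w ∈ Set.Icc (0 : Fin d → ℝ) 1 := by
  simp only [← Set.pi_univ_Icc, Set.mem_univ_pi, Fin.forall_fin_succ, Fin.cons_zero, Fin.cons_succ,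
    Pi.zero_apply, Pi.one_apply]

theorem cons_sub_cons_eq_smul {h : ℝ} (hh : h ≠ 0) (y s : ℝ) (x w : Fin d → ℝ) :
    (Fin.cons s w : Fin (d + 1) → ℝ) - Fin.cons y x =
      h • (Fin.cons ((s - y) / h) (scaled h x w) : Fin (d + 1) → ℝ) := by
  ext j
  refine Fin.cases ?_ (fun j => ?_) j <;> simp [scaled, mul_div_cancel₀, hh]

theorem norm_cons_le_one {u : ℝ} {v : Fin d → ℝ} (hu : |u| ≤ 1) (hv : ‖v‖ ≤ 1) :
    ‖(Fin.cons u v : Fin (d + 1) → ℝ)‖ ≤ 1 := by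
  refine (pi_norm_le_iff_of_nonneg zero_le_one).2 (Fin.cases (by simpa using hu) fun j => ?_)
  simpa using (norm_le_pi_norm v j).trans hv

/-- `F (s, w)` agrees up to `o(h^M)`, uniformly over the part of `[0,1] × [0,1]^d` within distance
`h` of `(y, x)`, with the polynomial of degree `M` whose derivatives at `(y, x)` are `θ`. -/
def HasUniformTaylor (F : ℝ → (Fin d → ℝ) → ℝ) (M : ℕ) (θ : ℕ → (Fin d → ℕ) → ℝ) (y : ℝ)
    (x : Fin d → ℝ) : Prop :=
  ∀ ε > 0, ∀ᶠ h in 𝓝[>] (0 : ℝ), ∀ s ∈ Set.Icc (0 : ℝ) 1, ∀ w ∈ Set.Icc (0 : Fin d → ℝ) 1,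
    |(s - y) / h| ≤ 1 → ‖scaled h x w‖ ≤ 1 →
      |F s w - taylorSum M θ h (fun k => ((s - y) / h) ^ k / (k.factorial : ℝ))
        (fun m => mono m (scaled h x w))| ≤ ε * h ^ M

variable {f : ℝ → (Fin d → ℝ) → ℝ} {M : ℕ} {y h : ℝ} {x : Fin d → ℝ}

theorem sum_iterPartial_mul_mono_eq_taylorSum (u : ℝ) (v : Fin d → ℝ) :
    ∑ m ∈ multiIdx (d + 1) M, iterPartial (multiWord m) (condCDFJoint f) (Fin.cons y x) *
        mono m (h • (Fin.cons u v : Fin (d + 1) → ℝ)) =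
      taylorSum M (fun k m => theta f k m y x) h (fun k => u ^ k / (k.factorial : ℝ))
        (fun m => mono m v) := by
  rw [sum_multiIdx_succ, taylorSum]
  refine Finset.sum_congr rfl fun t _ => ?_
  rw [mono_smul, mono_cons, theta, Fin.sum_cons]
  ring

theorem ThetaExistsContinuous.continuousOn_iterPartial {k : ℕ} {m : Fin d → ℕ}
    (hθ : ThetaExistsContinuous f k m) :
    ContinuousOn (iterPartial (multiWord (Fin.cons k m : Fin (d + 1) → ℕ)) (condCDFJoint f))
      (Set.Icc 0 1) := by
  have hcont : Continuous fun z : Fin (d + 1) → ℝ => (z 0, Fin.tail z) := by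
    unfold Fin.tail
    fun_prop
  refine (hθ.2.comp hcont.continuousOn fun z hz => ?_).congr fun z _ => ?_
  · rwa [← Fin.cons_self_tail z, cons_mem_cube_iff] at hz
  · simp [theta]

theorem hasUniformTaylor_condCDF
    (hθ : ∀ (k : ℕ) (m : Fin d → ℕ), k + ∑ j, m j = M → ThetaExistsContinuous f k m)
    (hy : y ∈ Set.Icc (0 : ℝ) 1) (hx : x ∈ Set.Icc (0 : Fin d → ℝ) 1) :
    HasUniformTaylor (condCDF f) M (fun k m => theta f k m y x) y x := by
  intro ε hε
  have ha := cons_mem_cube_iff.2 ⟨hy, hx⟩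
  have htaylor := (isLittleO_sub_taylor_multiIdx ha (L := M) (Φ := condCDFJoint f)
    fun m hm => by
      have hm' := hθ (m 0) (Fin.tail m) (by rw [← hm, Fin.sum_univ_succ]; rfl)
      have hcont := hm'.continuousOn_iterPartial
      rw [ThetaExistsContinuous, Fin.cons_self_tail] at hm'
      rw [Fin.cons_self_tail] at hcont
      exact ⟨hm'.1, hcont _ ha⟩).def hε
  obtain ⟨δ, hδ, hball⟩ := Metric.mem_nhdsWithin_iff.1 htaylor
  filter_upwards [Ioo_mem_nhdsGT hδ] with h hh s hs w hw hu hv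
  have hz := cons_sub_cons_eq_smul hh.1.ne' y s x w
  have hn : ‖(Fin.cons s w : Fin (d + 1) → ℝ) - Fin.cons y x‖ ≤ h := by
    rw [hz, norm_smul, Real.norm_of_nonneg hh.1.le]
    exact mul_le_of_le_one_right hh.1.le (norm_cons_le_one hu hv)
  have hle := hball ⟨mem_ball_iff_norm.2 (hn.trans_lt hh.2), cons_mem_cube_iff.2 ⟨hs, hw⟩⟩
  rw [Set.mem_ofPred_eq, norm_pow, norm_norm, hz, sum_iterPartial_mul_mono_eq_taylorSum,
    ← hz, condCDFJoint, Fin.cons_zero, Fin.tail_cons] at hle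
  exact hle.trans (by gcongr)

theorem continuousOn_condCDF {w : Fin d → ℝ} (hf : ContinuousOn (fun u => f u w) (Set.Icc 0 1)) :
    ContinuousOn (fun s => condCDF f s w) (Set.Icc 0 1) :=
  intervalIntegral.continuousOn_primitive_Icc
    ((hf.div_const _).integrableOn_compact isCompact_Icc)

end UniformTaylor

/-! ### Smoothing an approximate polynomial -/

theorem abs_integral_mul_sub_sum_le {A τ : Type*} [MeasurableSpace A] {m : Measure A}
    {S : Finset τ} {φ w : A → ℝ} {b : τ → A → ℝ} {C : τ → ℝ} {B : ℝ} (hw : Integrable w m)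
    (hφw : Integrable (fun a => φ a * w a) m)
    (hbw : ∀ t ∈ S, Integrable (fun a => b t a * w a) m)
    (hB : ∀ᵐ a ∂m, w a ≠ 0 → |φ a - ∑ t ∈ S, C t * b t a| ≤ B) :
    |∫ a, φ a * w a ∂m - ∑ t ∈ S, C t * ∫ a, b t a * w a ∂m| ≤ B * ∫ a, |w a| ∂m := by
  have hCbw : ∀ t ∈ S, Integrable (fun a => C t * (b t a * w a)) m :=
    fun t ht => (hbw t ht).const_mul _
  simp_rw [← integral_const_mul]
  rw [← integral_finsetSum _ hCbw, ← integral_sub hφw (integrable_finsetSum _ hCbw),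
    ← Real.norm_eq_abs]
  refine norm_integral_le_of_norm_le (hw.abs.const_mul B) ?_
  filter_upwards [hB] with a ha
  have hfactor : φ a * w a - ∑ t ∈ S, C t * (b t a * w a) =
      (φ a - ∑ t ∈ S, C t * b t a) * w a := by
    simp only [sub_mul, Finset.sum_mul, mul_assoc]
  rw [hfactor, norm_mul, Real.norm_eq_abs, Real.norm_eq_abs]
  by_cases hwa : w a = 0
  · simp [hwa]
  · exact mul_le_mul_of_nonneg_right (ha hwa) (abs_nonneg _)

theorem abs_sum_mul_sub_sum_le {σ τ : Type*} {N : Finset σ} {S : Finset τ} {φ w : σ → ℝ}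
    {b : τ → σ → ℝ} {C : τ → ℝ} {B c : ℝ} (hc : 0 ≤ c)
    (hB : ∀ i ∈ N, w i ≠ 0 → |φ i - ∑ t ∈ S, C t * b t i| ≤ B) :
    |c * ∑ i ∈ N, φ i * w i - ∑ t ∈ S, C t * (c * ∑ i ∈ N, b t i * w i)| ≤
      B * (c * ∑ i ∈ N, |w i|) := by
  have hfactor : c * ∑ i ∈ N, φ i * w i - ∑ t ∈ S, C t * (c * ∑ i ∈ N, b t i * w i) =
      c * ∑ i ∈ N, (φ i - ∑ t ∈ S, C t * b t i) * w i := by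
    simp only [sub_mul, Finset.sum_sub_distrib, mul_sub, Finset.sum_mul, Finset.mul_sum]
    rw [Finset.sum_comm]
    exact congrArg _ (Finset.sum_congr rfl fun t _ => Finset.sum_congr rfl fun i _ => by ring)
  rw [hfactor, abs_mul, abs_of_nonneg hc, mul_left_comm, Finset.mul_sum]
  refine mul_le_mul_of_nonneg_left (Finset.abs_sum_le_sum_abs _ _ |>.trans
    (Finset.sum_le_sum fun i hi => ?_)) hc
  rw [abs_mul]
  by_cases hwi : w i = 0
  · simp [hwi]
  · exact mul_le_mul_of_nonneg_right (hB i hi hwi) (abs_nonneg _)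

theorem eventually_of_mul_tendsto {ι : Type*} {l : Filter ι} {p : ι → ℝ → Prop} {A : ι → ℝ}
    {a : ℝ} (hp : ∀ᶠ i in l, Monotone (p i)) (hA : Tendsto A l (𝓝 a))
    (h : ∀ ε > 0, ∀ᶠ i in l, p i (ε * A i)) {ε : ℝ} (hε : 0 < ε) : ∀ᶠ i in l, p i ε := by
  have hpos : 0 < |a| + 1 := by positivity
  filter_upwards [hp, h (ε / (|a| + 1)) (by positivity),
    hA.eventually_le_const ((le_abs_self a).trans_lt (lt_add_one _))] with i hpi hi hAi
  refine hpi ?_ hi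
  calc ε / (|a| + 1) * A i ≤ ε / (|a| + 1) * (|a| + 1) := by gcongr
    _ = ε := div_mul_cancel₀ _ hpos.ne'

theorem isLittleO_of_mul_tendsto {ι : Type*} {l : Filter ι} {E r A : ι → ℝ} {a : ℝ}
    (hr : ∀ᶠ i in l, 0 ≤ r i) (hA : Tendsto A l (𝓝 a))
    (h : ∀ ε > 0, ∀ᶠ i in l, |E i| ≤ ε * r i * A i) : E =o[l] r := by
  refine isLittleO_iff.2 fun ε hε => eventually_of_mul_tendsto (p := fun i c => ‖E i‖ ≤ c * ‖r i‖)
    (.of_forall fun i c c' hc hle => hle.trans (by gcongr)) hA (fun ε hε => ?_) hε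
  filter_upwards [hr, h ε hε] with i hri hle
  rwa [Real.norm_eq_abs, Real.norm_of_nonneg hri, mul_right_comm]

theorem isCompact_setOf_add_mul_mem_Icc {h : ℝ} (hh : h ≠ 0) (y : ℝ) :
    IsCompact {u : ℝ | y + h * u ∈ Set.Icc (0 : ℝ) 1} :=
  ((Homeomorph.mulLeft₀ h hh).trans (Homeomorph.addLeft y)).isCompact_preimage.2 isCompact_Icc

theorem integralDG_rescaled (G : ℝ → ℝ) {h : ℝ} (hh : 0 < h) (y : ℝ) (φ ψ : ℝ → ℝ) :
    integralDG G (fun u => φ u * (1 / h * ψ ((u - y) / h))) =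
      ∫ u in {u : ℝ | y + h * u ∈ Set.Icc (0 : ℝ) 1},
        φ (y + h * u) * (ψ u * weightDensity G (y + h * u)) := by
  rw [integralDG, setIntegral_eq_rescaled volume measurableSet_Icc _ y hh, Module.finrank_self,
    pow_one, ← integral_const_mul]
  simp only [smul_eq_mul, add_sub_cancel_left, mul_div_cancel_left₀ _ hh.ne']
  congr 1
  field_simp

section Deterministic

variable {ι : Type*} {l : Filter ι} {d : ℕ}

/-- The functions `I i` of the covariates agree up to `o(h^M)`, uniformly over the part of `[0,1]^d`
within distance `h` of `x`, with a Taylor polynomial whose monomials `u^k/k!` in the response have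
been smoothed to `γ i k`. -/
def HasSmoothedTaylor (I : ι → (Fin d → ℝ) → ℝ) (γ : ι → ℕ → ℝ) (l : Filter ι) (h : ι → ℝ) (M : ℕ)
    (θ : ℕ → (Fin d → ℕ) → ℝ) (x : Fin d → ℝ) : Prop :=
  ∀ ε > 0, ∀ᶠ i in l, ∀ w ∈ Set.Icc (0 : Fin d → ℝ) 1, ‖scaled (h i) x w‖ ≤ 1 →
    |I i w - taylorSum M θ (h i) (γ i) (fun m => mono m (scaled (h i) x w))| ≤ ε * h i ^ M

variable {M p : ℕ} {F : ℝ → (Fin d → ℝ) → ℝ} {K G : ℝ → ℝ} {y : ℝ} {x : Fin d → ℝ} {h : ι → ℝ}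
  {θ : ℕ → (Fin d → ℕ) → ℝ}

theorem HasSmoothedTaylor.of_mul_tendsto {I : ι → (Fin d → ℝ) → ℝ} {γ : ι → ℕ → ℝ} {A : ι → ℝ}
    {a : ℝ} (hh : ∀ᶠ i in l, 0 < h i) (hA : Tendsto A l (𝓝 a))
    (hI : ∀ ε > 0, ∀ᶠ i in l, ∀ w ∈ Set.Icc (0 : Fin d → ℝ) 1, ‖scaled (h i) x w‖ ≤ 1 →
      |I i w - taylorSum M θ (h i) (γ i) (fun m => mono m (scaled (h i) x w))| ≤
        ε * h i ^ M * A i) :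
    HasSmoothedTaylor I γ l h M θ x := by
  refine fun ε hε => eventually_of_mul_tendsto
    (p := fun i c => ∀ w ∈ Set.Icc (0 : Fin d → ℝ) 1, ‖scaled (h i) x w‖ ≤ 1 →
      |I i w - taylorSum M θ (h i) (γ i) (fun m => mono m (scaled (h i) x w))| ≤ c * h i ^ M)
    (hh.mono fun i hi c c' hc hle w hw hv => (hle w hw hv).trans (by gcongr)) hA
    (fun ε hε => ?_) hε
  simpa only [mul_right_comm] using hI ε hε

theorem HasUniformTaylor.integralDG (hF : HasUniformTaylor F M θ y x)
    (hFc : ∀ w ∈ Set.Icc (0 : Fin d → ℝ) 1, ContinuousOn (fun s => F s w) (Set.Icc 0 1))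
    (hK : IsContinuousKernel K) (hg : ContinuousOn (weightDensity G) (Set.Icc 0 1))
    (hy : y ∈ Set.Icc (0 : ℝ) 1) (hh : Tendsto h l (𝓝[>] 0)) (a : Fin (p + 1)) :
    HasSmoothedTaylor
      (fun i w => integralDG G fun u => F u w * (1 / h i * PVec K p ((u - y) / h i) a))
      (fun i k => cY K G p k (h i) y a) l h M θ x := by
  have hA := tendsto_setIntegral_Icc_rescaled hy hh hg.abs (hK.continuous_PVec p a).abs
    (hK.hasCompactSupport_PVec p a).norm
  refine .of_mul_tendsto (tendsto_nhdsWithin_iff.1 hh).2 hA fun ε hε => ?_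
  filter_upwards [hh.eventually (hF ε hε), (tendsto_nhdsWithin_iff.1 hh).2] with i hi hpos w hw hv
  have hpos : 0 < h i := hpos
  have hwin := isCompact_setOf_add_mul_mem_Icc hpos.ne' y
  have hmaps : Set.MapsTo (fun u : ℝ => y + h i * u)
    {u : ℝ | y + h i * u ∈ Set.Icc (0 : ℝ) 1} (Set.Icc 0 1) := fun u hu => hu
  have hPg : ContinuousOn (fun u => PVec K p u a * weightDensity G (y + h i * u))
      {u : ℝ | y + h i * u ∈ Set.Icc (0 : ℝ) 1} :=
    (hK.continuous_PVec p a).continuousOn.mul (hg.comp (by fun_prop) hmaps)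
  have key := abs_integral_mul_sub_sum_le
    (m := volume.restrict {u : ℝ | y + h i * u ∈ Set.Icc (0 : ℝ) 1})
    (S := degPairs d M) (B := ε * h i ^ M) (φ := fun u => F (y + h i * u) w)
    (C := fun t => h i ^ (t.1 + ∑ j, t.2 j) * θ t.1 t.2)
    (b := fun t u => u ^ t.1 / (t.1.factorial : ℝ) * mono t.2 (scaled (h i) x w))
    (hPg.integrableOn_compact hwin)
    ((((hFc w hw).comp (by fun_prop) hmaps).mul hPg).integrableOn_compact hwin)
    (fun t _ => (ContinuousOn.mul (by fun_prop) hPg).integrableOn_compact hwin) ?_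
  · rw [integralDG_rescaled G hpos y (fun s => F s w) fun u => PVec K p u a]
    simp only [abs_mul (PVec K p _ a)] at key
    convert key using 3
    refine Finset.sum_congr rfl fun t _ => ?_
    simp only [cY, ← integral_mul_const]
    congr 2
    ext u
    ring
  · filter_upwards [ae_restrict_mem hwin.measurableSet] with u hu hne
    have hu1 : |u| ≤ 1 := not_lt.1 fun hlt => hne (by rw [hK.PVec_eq_zero hlt, zero_mul])
    have hus : (y + h i * u - y) / h i = u := by
      rw [add_sub_cancel_left, mul_div_cancel_left₀ _ hpos.ne']
    simpa only [hus, taylorSum] using hi _ hu w hw (by rwa [hus]) hv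

end Deterministic

namespace IsCubeSample

variable {Ω : Type*} [MeasurableSpace Ω] {P : Measure Ω} [IsProbabilityMeasure P] {d : ℕ}
  {Y : ℕ → Ω → ℝ} {X : ℕ → Ω → Fin d → ℝ} {f : ℝ → (Fin d → ℝ) → ℝ}
  (hD : IsCubeSample P Y X f) {h : ℕ → ℝ} (hpos : ∀ n, 0 < h n) (hzero : Tendsto h atTop (𝓝 0))
  {K : ℝ → ℝ} (hK : IsContinuousKernel K) {M : ℕ} {θ : ℕ → (Fin d → ℕ) → ℝ} {x : Fin d → ℝ}
include hD hpos hzero hK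

theorem hasSmoothedTaylor_average (hrate : Tendsto (fun n : ℕ => (n : ℝ) * h n) atTop atTop)
    {y : ℝ} (hy : y ∈ Set.Icc (0 : ℝ) 1) {F : ℝ → (Fin d → ℝ) → ℝ}
    (hF : HasUniformTaylor F M θ y x) {p : ℕ} (a : Fin (p + 1)) :
    HasSmoothedTaylor (fun (z : ℕ × Ω) w => 1 / ((z.1 : ℝ) * h z.1) * ∑ j ∈ Finset.range z.1,
        F (Y j z.2) w * PVec K p ((Y j z.2 - y) / h z.1) a)
      (fun z k => cYhat K p z.1 (fun i => Y i z.2) k (h z.1) y a) (inProbability P atTop)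
      (fun z => h z.1) M θ x := by
  have hh : Tendsto h atTop (𝓝[>] 0) := tendsto_nhdsWithin_iff.2 ⟨hzero, .of_forall hpos⟩
  have hA := hD.tendsto_average_Y hpos hzero hrate hy (hK.continuous_PVec p a).abs
    (hK.hasCompactSupport_PVec p a).norm
  refine .of_mul_tendsto (.of_forall fun z => hpos z.1) hA fun ε hε => ?_
  filter_upwards [(hh.comp tendsto_fst_inProbability).eventually (hF ε hε),
    eventually_inProbability_of_ae (ae_all_iff.2 hD.ae_mem_cube)] with z hz hmem w hw hv
  have key := abs_sum_mul_sub_sum_le (N := Finset.range z.1) (S := degPairs d M)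
    (B := ε * h z.1 ^ M) (c := 1 / ((z.1 : ℝ) * h z.1)) (φ := fun j => F (Y j z.2) w)
    (w := fun j => PVec K p ((Y j z.2 - y) / h z.1) a)
    (C := fun t => h z.1 ^ (t.1 + ∑ j, t.2 j) * θ t.1 t.2)
    (b := fun t j => ((Y j z.2 - y) / h z.1) ^ t.1 / (t.1.factorial : ℝ) *
      mono t.2 (scaled (h z.1) x w)) (by have := hpos z.1; positivity) fun j _ hne => ?_
  · convert key using 3
    refine Finset.sum_congr rfl fun t _ => ?_
    simp only [cYhat, mul_assoc, Finset.sum_mul, mul_comm (mono t.2 _)]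
  · exact hz _ (hmem j).1 w hw (not_lt.1 fun hlt => hne (hK.PVec_eq_zero hlt)) hv

theorem isLittleO_average_sub_taylorSum
    (hrate : Tendsto (fun n : ℕ => (n : ℝ) * h n ^ d) atTop atTop)
    (hx : x ∈ Set.Icc (0 : Fin d → ℝ) 1) {I : ℕ × Ω → (Fin d → ℝ) → ℝ} {γ : ℕ × Ω → ℕ → ℝ}
    (hI : HasSmoothedTaylor I γ (inProbability P atTop) (fun z => h z.1) M θ x) {q : ℕ}
    (b : multiIdx d q) :
    (fun z : ℕ × Ω => 1 / ((z.1 : ℝ) * h z.1 ^ d) *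
        ∑ i ∈ Finset.range z.1, I z (X i z.2) * QVec K q (scaled (h z.1) x (X i z.2)) b -
      taylorSum M θ (h z.1) (γ z) (fun m => cXhat K q z.1 (fun i => X i z.2) m (h z.1) x b))
      =o[inProbability P atTop] fun z => h z.1 ^ M := by
  have hA := hD.tendsto_average_X hpos hzero hrate hx (hK.continuous_QVec q b).abs
    (hK.hasCompactSupport_QVec q b).norm
  refine isLittleO_of_mul_tendsto (.of_forall fun z => (pow_pos (hpos z.1) M).le) hA
    fun ε hε => ?_
  filter_upwards [hI ε hε,
    eventually_inProbability_of_ae (ae_all_iff.2 hD.ae_mem_cube)] with z hz hmem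
  have key := abs_sum_mul_sub_sum_le (N := Finset.range z.1) (S := degPairs d M)
    (B := ε * h z.1 ^ M) (c := 1 / ((z.1 : ℝ) * h z.1 ^ d)) (φ := fun i => I z (X i z.2))
    (w := fun i => QVec K q (scaled (h z.1) x (X i z.2)) b)
    (C := fun t => h z.1 ^ (t.1 + ∑ j, t.2 j) * θ t.1 t.2)
    (b := fun t i => γ z t.1 * mono t.2 (scaled (h z.1) x (X i z.2)))
    (by have := hpos z.1; positivity) fun i _ hne =>
      hz _ (hmem i).2 (not_lt.1 fun hlt => hne (hK.QVec_eq_zero hlt))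
  convert key using 3
  refine Finset.sum_congr rfl fun t _ => ?_
  simp only [cXhat, mul_assoc (γ z _), ← Finset.mul_sum]
  ring

end IsCubeSample

/-! ### The two conditional means -/

section Brackets

variable {d p q n : ℕ} {h : ℝ}

theorem RbarMean_apply (hh : h ≠ 0) (K G : ℝ → ℝ) (f : ℝ → (Fin d → ℝ) → ℝ) (μ : ℕ)
    (ν : Fin d → ℕ) (xs : ℕ → Fin d → ℝ) (y : ℝ) (x : Fin d → ℝ) (a : Fin (p + 1))
    (b : multiIdx d q) :
    RbarMean K G f p q μ ν n xs h y x a b =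
      (1 / ((n : ℝ) * h ^ d) * ∑ i ∈ Finset.range n,
        integralDG G (fun u => condCDF f u (xs i) * (1 / h * PVec K p ((u - y) / h) a)) *
          QVec K q (scaled h x (xs i)) b) / h ^ (μ + ∑ j, ν j) := by
  simp only [RbarMean, Matrix.of_apply, Finset.mul_sum, Finset.sum_div]
  exact Finset.sum_congr rfl fun i _ => by field_simp

theorem RhatMean_apply (hh : h ≠ 0) (K : ℝ → ℝ) (f : ℝ → (Fin d → ℝ) → ℝ) (μ : ℕ)
    (ν : Fin d → ℕ) (ys : ℕ → ℝ) (xs : ℕ → Fin d → ℝ) (y : ℝ) (x : Fin d → ℝ) (a : Fin (p + 1))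
    (b : multiIdx d q) :
    RhatMean K f p q μ ν n ys xs h y x a b =
      (1 / ((n : ℝ) * h ^ d) * ∑ i ∈ Finset.range n,
        (1 / ((n : ℝ) * h) * ∑ j ∈ Finset.range n,
          condCDF f (ys j) (xs i) * PVec K p ((ys j - y) / h) a) *
          QVec K q (scaled h x (xs i)) b) / h ^ (μ + ∑ j, ν j) := by
  simp only [RhatMean, Matrix.of_apply, Finset.mul_sum, Finset.sum_mul, Finset.sum_div]
  exact Finset.sum_congr rfl fun i _ => Finset.sum_congr rfl fun j _ => by field_simp

end Brackets

namespace IsCubeSample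

variable {Ω : Type*} [MeasurableSpace Ω] {P : Measure Ω} [IsProbabilityMeasure P] {d : ℕ}
  {Y : ℕ → Ω → ℝ} {X : ℕ → Ω → Fin d → ℝ} {f : ℝ → (Fin d → ℝ) → ℝ}
  (hD : IsCubeSample P Y X f) {h : ℕ → ℝ} (hpos : ∀ n, 0 < h n) (hzero : Tendsto h atTop (𝓝 0))
  {K : ℝ → ℝ} (hK : IsContinuousKernel K)
  (hrate : Tendsto (fun n : ℕ => (n : ℝ) * h n ^ d) atTop atTop)
  {p q μ : ℕ} {ν : Fin d → ℕ} (hμ : μ ≤ p) (hν : ∑ j, ν j ≤ q)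
  {y : ℝ} {x : Fin d → ℝ} (hx : x ∈ Set.Icc (0 : Fin d → ℝ) 1)
include hD hpos hzero hK hrate hμ hν hx

theorem isLittleO_sandwich_average_sub_leadingBias {θ : ℕ → (Fin d → ℕ) → ℝ}
    {cy cy' : ℕ × Ω → ℕ → Fin (p + 1) → ℝ}
    (hcy : TendstoMultiple cy (inProbability P atTop) (coneMomentIcc K p y))
    (hcy' : TendstoMultiple cy' (inProbability P atTop) (coneMomentIcc K p y))
    (hsymm : ∀ z, (momentMatrix Fin.val (cy z)).IsSymm)
    {I : Fin (p + 1) → ℕ × Ω → (Fin d → ℝ) → ℝ}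
    (hI : ∀ a, HasSmoothedTaylor (I a) (fun z k => cy z k a) (inProbability P atTop)
      (fun z => h z.1) (max (q + 1 + μ) (p + 1 + ∑ j, ν j)) θ x)
    {R : ℕ × Ω → Matrix (Fin (p + 1)) (multiIdx d q) ℝ}
    (hR : ∀ z a b, R z a b = (1 / ((z.1 : ℝ) * h z.1 ^ d) * ∑ i ∈ Finset.range z.1,
      I a z (X i z.2) * QVec K q (scaled (h z.1) x (X i z.2)) b) / h z.1 ^ (μ + ∑ j, ν j)) :
    (fun z : ℕ × Ω => eY p μ ⬝ᵥ ((momentMatrix Fin.val (cy z))⁻¹ * R z *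
        (SXhat K q z.1 (fun i => X i z.2) (h z.1) x)⁻¹) *ᵥ eX q ν -
      (θ μ ν + leadingBiasOf μ ν θ (cy' z) (fun m => cX K f q m (h z.1) x) (h z.1)))
      =o[inProbability P atTop] fun z => biasRate p q μ ν (h z.1) := by
  have hh : Tendsto (fun z : ℕ × Ω => h z.1) (inProbability P atTop) (𝓝[>] 0) :=
    (tendsto_nhdsWithin_iff.2 ⟨hzero, .of_forall hpos⟩).comp tendsto_fst_inProbability
  refine isLittleO_sandwich_sub_leadingBias hμ hν (le_max_left _ _) (le_max_right _ _) hh hcy hcy'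
    (hD.tendstoMultiple_cXhat hpos hzero hK hrate hx q)
    (hK.tendstoMultiple_cX hh hx hD.continuousOn_marginalX (hD.marginalX_pos hx).ne' q)
    (hK.det_momentMatrix_coneMomentIcc_ne_zero p y)
    (hK.det_momentMatrix_coneMomentCube_ne_zero q x) hsymm fun a b => ?_
  have havg := (hD.isLittleO_average_sub_taylorSum hpos hzero hK hrate hx (hI a) b).mul_isBigO
    (isBigO_refl (fun z : ℕ × Ω => (h z.1 ^ (μ + ∑ j, ν j))⁻¹) _)
  simpa only [hR, ← div_eq_mul_inv, sub_div] using havg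

variable (hθ : ∀ (k : ℕ) (m : Fin d → ℕ), k + ∑ j, m j = max (q + 1 + μ) (p + 1 + ∑ j, ν j) →
    ThetaExistsContinuous f k m)
  (hy : y ∈ Set.Icc (0 : ℝ) 1) {G : ℝ → ℝ} (hg : ContinuousOn (weightDensity G) (Set.Icc 0 1))
  (hgy : weightDensity G y ≠ 0)
include hθ hy hg hgy

theorem isLittleO_meanCheck_sub :
    (fun z : ℕ × Ω => meanCheck K G f p q μ ν z.1 (fun i => X i z.2) (h z.1) y x -
      (theta f μ ν y x + leadingBias K G f p q μ ν (h z.1) y x))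
      =o[inProbability P atTop] fun z => biasRate p q μ ν (h z.1) := by
  have hh : Tendsto (fun z : ℕ × Ω => h z.1) (inProbability P atTop) (𝓝[>] 0) :=
    (tendsto_nhdsWithin_iff.2 ⟨hzero, .of_forall hpos⟩).comp tendsto_fst_inProbability
  have hcy := hK.tendstoMultiple_cY hh hy hg hgy p
  exact hD.isLittleO_sandwich_average_sub_leadingBias hpos hzero hK hrate hμ hν hx hcy hcy
    (fun z => isSymm_momentMatrix_cY p (h z.1))
    ((hasUniformTaylor_condCDF hθ hy hx).integralDG
      (fun w hw => continuousOn_condCDF (hD.continuousOn_density_left hw)) hK hg hy hh)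
    fun z => RbarMean_apply (hpos z.1).ne' K G f μ ν _ y x

theorem isLittleO_meanHat_sub (hd : 1 ≤ d) :
    (fun z : ℕ × Ω =>
      meanHat K f p q μ ν z.1 (fun i => Y i z.2) (fun i => X i z.2) (h z.1) y x -
        (theta f μ ν y x + leadingBias K G f p q μ ν (h z.1) y x))
      =o[inProbability P atTop] fun z => biasRate p q μ ν (h z.1) := by
  have hh : Tendsto (fun z : ℕ × Ω => h z.1) (inProbability P atTop) (𝓝[>] 0) :=
    (tendsto_nhdsWithin_iff.2 ⟨hzero, .of_forall hpos⟩).comp tendsto_fst_inProbability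
  have hrateY := tendsto_mul_of_tendsto_mul_pow hd hpos hzero hrate
  exact hD.isLittleO_sandwich_average_sub_leadingBias hpos hzero hK hrate hμ hν hx
    (hD.tendstoMultiple_cYhat hpos hzero hK hrateY hy p) (hK.tendstoMultiple_cY hh hy hg hgy p)
    (fun z => isSymm_momentMatrix_cYhat K p z.1 _ (h z.1) y)
    (hD.hasSmoothedTaylor_average hpos hzero hK hrateY hy (hasUniformTaylor_condCDF hθ hy hx))
    fun z => RhatMean_apply (hpos z.1).ne' K f μ ν _ _ y x

end IsCubeSample

end CondDist

theorem mainTheorem8_general {Ω : Type*} [MeasurableSpace Ω] (P : Measure Ω)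
    [IsProbabilityMeasure P] (d : ℕ) (hd : 1 ≤ d)
    (Y : ℕ → Ω → ℝ) (X : ℕ → Ω → Fin d → ℝ) (f : ℝ → (Fin d → ℝ) → ℝ)
    (hD : CondDist.IsCubeSample P Y X f)
    (K : ℝ → ℝ) (hK : CondDist.IsContinuousKernel K)
    (G : ℝ → ℝ) (hG : ContDiffOn ℝ 1 G (Set.Icc 0 1))
    (h : ℕ → ℝ) (hpos : ∀ n, 0 < h n) (hzero : Tendsto h atTop (𝓝 0))
    (hrate : Tendsto (fun n : ℕ => (n : ℝ) * h n ^ d) atTop atTop)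
    (p q μ : ℕ) (ν : Fin d → ℕ) (hμ : μ ≤ p) (hν : ∑ j, ν j ≤ q)
    (hsmooth : ∀ (μ' : ℕ) (ν' : Fin d → ℕ),
      μ' + ∑ j, ν' j = max (q + 1 + μ) (p + 1 + ∑ j, ν j) →
        CondDist.ThetaExistsContinuous f μ' ν')
    (y : ℝ) (hy : y ∈ Set.Icc (0 : ℝ) 1) (x : Fin d → ℝ) (hx : x ∈ Set.Icc (0 : Fin d → ℝ) 1)
    (hgy : CondDist.weightDensity G y ≠ 0) :
    TendstoInMeasure P
      (fun (n : ℕ) (ω : Ω) =>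
        (CondDist.meanCheck K G f p q μ ν n (fun i => X i ω) (h n) y x
          - (CondDist.theta f μ ν y x + CondDist.leadingBias K G f p q μ ν (h n) y x))
        / CondDist.biasRate p q μ ν (h n))
      atTop (fun _ => (0 : ℝ)) ∧
    TendstoInMeasure P
      (fun (n : ℕ) (ω : Ω) =>
        (CondDist.meanHat K f p q μ ν n (fun i => Y i ω) (fun i => X i ω) (h n) y x
          - (CondDist.theta f μ ν y x + CondDist.leadingBias K G f p q μ ν (h n) y x))
        / CondDist.biasRate p q μ ν (h n))
      atTop (fun _ => (0 : ℝ)) := by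
  have hg : ContinuousOn (CondDist.weightDensity G) (Set.Icc 0 1) :=
    hG.continuousOn_derivWithin (uniqueDiffOn_Icc zero_lt_one) le_rfl
  exact
    ⟨CondDist.tendsto_inProbability_iff.1 (hD.isLittleO_meanCheck_sub hpos hzero hK hrate hμ hν hx
      hsmooth hy hg hgy).tendsto_div_nhds_zero,
    CondDist.tendsto_inProbability_iff.1 (hD.isLittleO_meanHat_sub hpos hzero hK hrate hμ hν hx
      hsmooth hy hg hgy hd).tendsto_div_nhds_zero⟩

theorem mainTheorem8 {Ω : Type*} [MeasurableSpace Ω] (P : Measure Ω) [IsProbabilityMeasure P]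
    (d : ℕ) (hd : 1 ≤ d)
    (Y : ℕ → Ω → ℝ) (X : ℕ → Ω → Fin d → ℝ) (f : ℝ → (Fin d → ℝ) → ℝ)
    (hDGP : CondDist.IsDGP P Y X f)
    (K : ℝ → ℝ) (hK : CondDist.IsKernelFun K)
    (G : ℝ → ℝ) (hG : ContDiffOn ℝ 1 G (Set.Icc 0 1))
    (h : ℕ → ℝ) (hpos : ∀ n, 0 < h n) (hzero : Tendsto h atTop (𝓝 0))
    (hrate : Tendsto (fun n : ℕ => (n : ℝ) * h n ^ d / Real.log n) atTop atTop)
    (p q μ : ℕ) (ν : Fin d → ℕ) (hμ : μ ≤ p) (hν : ∑ j, ν j ≤ q)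
    (hsmooth : ∀ (μ' : ℕ) (ν' : Fin d → ℕ),
      μ' + ∑ j, ν' j = max (q + 1 + μ) (p + 1 + ∑ j, ν j) →
        CondDist.ThetaExistsContinuous f μ' ν')
    (y : ℝ) (hy : y ∈ Set.Icc (0 : ℝ) 1) (x : Fin d → ℝ) (hx : x ∈ Set.Icc (0 : Fin d → ℝ) 1)
    (hgy : CondDist.weightDensity G y ≠ 0) :
    TendstoInMeasure P
      (fun (n : ℕ) (ω : Ω) =>
        (CondDist.meanCheck K G f p q μ ν n (fun i => X i ω) (h n) y x
          - (CondDist.theta f μ ν y x + CondDist.leadingBias K G f p q μ ν (h n) y x))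
        / CondDist.biasRate p q μ ν (h n))
      atTop (fun _ => (0 : ℝ)) ∧
    TendstoInMeasure P
      (fun (n : ℕ) (ω : Ω) =>
        (CondDist.meanHat K f p q μ ν n (fun i => Y i ω) (fun i => X i ω) (h n) y x
          - (CondDist.theta f μ ν y x + CondDist.leadingBias K G f p q μ ν (h n) y x))
        / CondDist.biasRate p q μ ν (h n))
      atTop (fun _ => (0 : ℝ)) :=
  mainTheorem8_general P d hd Y X f hDGP.isCubeSample K hK.isContinuousKernel G hG h hpos hzero
    (CondDist.tendsto_mul_pow_of_tendsto_div_log hpos hrate) p q μ ν hμ hν hsmooth y hy x hx hgy
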